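/- Let $d\ge 1$, $T>0$, $I=(0,T)$, and let $\Omega\subset\mathbb R^d$ be open. Let $a_{ij}\in L^\infty(I\times\Omega)$ ($1\le i,j\le d$) satisfy, for a.e. $(t,x)\in I\times\Omega$, $a_{ij}=a_{ji}$ and $\sum_{i,j}a_{ij}(t,x)\xi_i\xi_j\ge\alpha|\xi|^2$ for all $\xi\in\mathbb R^d$, with a constant $\alpha>0$. Assume that $t\mapsto a_{ij}(t,x)$ is continuous on $[0,T]$ for a.e. $x\in\Omega$ and that $|a_{ij}(t_1,x)-a_{ij}(t_2,x)|\le\omega(|t_1-t_2|)$ for all $t_1,t_2\in[0,T]$ and a.e. $x\in\Omega$, where $\omega:[0,T]\to[0,\infty)$ is nondecreasing, $\omega(s)s^{-3/2}$ is non-increasing on $(0,T]$ and $\int_0^T\omega(s)s^{-3/2}\,ds<\infty$. Put $a(t;u,v)=\int_\Omega\sum_{i,j}a_{ij}(t,x)\,\partial_iu\,\partial_jv\,dx$ for $u,v\in H^1_0(\Omega)$. For a partition $0=t_0<t_1<\dots<t_M=T$ let $I_m=(t_{m-1},t_m]$, $k_m=t_m-t_{m-1}$, $k=\max_mk_m$,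 $k_{\min}=\min_mk_m$. Let constants $c,\beta,\kappa>0$ be given and call a partition admissible if $k_{\min}\ge c\,k^\beta$, $\kappa^{-1}\le k_m/k_{m+1}\le\kappa$ for $1\le m\le M-1$, and $k\le T/4$. For a conformal triangulation $\mathcal T$ of $\Omega$ (a finite set of closed nondegenerate $d$-simplices with union $\overline\Omega$, any two of which are disjoint or meet in a common face) and $r\ge1$ let $V_h$ be the space of all functions in $H^1_0(\Omega)$ that are polynomials of degree at most $r$ on each $\tau\in\mathcal T$; no shape regularity or quasi-uniformity is assumed. Let $X$ be the space of functions of time with values in $V_h$ that are constant on each $I_m$, and write $v_m=v|_{I_m}$ for $v\in X$. For $f\in L^p(I;L^2(\Omega))$ the dG(0)cG($r$) solution with initial value $u_0=0$ is $u\in X$ with $$\int_0^Ta(t;u(t),\varphi(t))\,dt+\sum_{m=2}^M(u_m-u_{m-1},\varphi_m)_{L^2(\Omega)}+(u_1,\varphi_1)_{L^2(\Omega)}=\int_0^T(f(t),\varphi(t))_{L^2(\Omega)}\,dt\qquad\text{for all }\varphi\in X.$$ Let $A_h(t):V_h\to V_h$ be defined by $(A_h(t)v,\chi)_{L^2(\Omega)}=a(t;v,\chi)$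 for all $\chi\in V_h$, let $A_{kh,m}=\frac1{k_m}\int_{I_m}A_h(t)\,dt$, and let $[u]_0=u_1$ and $[u]_{m-1}=u_m-u_{m-1}$ for $2\le m\le M$. Then there are constants $\mu>0$, $\delta_0>0$ and $C>0$, depending only on $d,T,\Omega,(a_{ij}),\alpha,\omega,c,\beta,\kappa$, such that for every admissible partition with $k-k_{\min}\le\delta_0$, every conformal triangulation of $\Omega$, every $r\ge1$, every $1\le p<\infty$, every $f\in L^p(I;L^2(\Omega))$ and the corresponding dG(0)cG($r$) solution $u$, $$\left[\sum_{m=1}^M\left(\|A_{kh,m}u_m\|^p_{L^p(I_m;L^2(\Omega))}+k_m\left\|\frac{[u]_{m-1}}{k_m}\right\|^p_{L^2(\Omega)}\right)\right]^{1/p}\le C\,e^{\mu T}\,\ln\frac Tk\;\|f\|_{L^p(I;L^2(\Omega))}.$$ In particular the constants do not depend on the time mesh (hence not on $k$), on the triangulation (hence not on its mesh size $h$), on $r$, on $p$ or on $f$. -/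

import Mathlib

open MeasureTheory Set

noncomputable section

namespace DGMaxReg

/-- Euclidean space `ℝ^d`. -/
abbrev Pt (d : ℕ) : Type := EuclideanSpace ℝ (Fin d)

/-- The Lebesgue space `L²(Ω)`. -/
abbrev L2 {d : ℕ} (Ω : Set (Pt d)) : Type := Lp ℝ 2 (volume.restrict Ω)

/-- The space `L²(Ω)^d` of square-integrable vector fields. -/
abbrev L2Vec {d : ℕ} (Ω : Set (Pt d)) : Type := Lp (Pt d) 2 (volume.restrict Ω)

/-- The pairs `(φ, ∇φ)` with `φ ∈ C_c^∞(Ω)`. -/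
def testPairs {d : ℕ} (Ω : Set (Pt d)) : Set (L2 Ω × L2Vec Ω) :=
  {z | ∃ φ : Pt d → ℝ, ContDiff ℝ (⊤ : ℕ∞) φ ∧ HasCompactSupport φ ∧ tsupport φ ⊆ Ω ∧
    (∀ᵐ x ∂(volume.restrict Ω), z.1 x = φ x) ∧
    (∀ᵐ x ∂(volume.restrict Ω), z.2 x = gradient φ x)}

/-- The Sobolev space `H¹₀(Ω)`: the closure of `C_c^∞(Ω)` in the `H¹` norm.  A function `u` is
represented by the pair `(u, ∇u)` of the function and its weak gradient. -/
def H10 {d : ℕ} (Ω : Set (Pt d)) : Submodule ℝ (L2 Ω × L2Vec Ω) :=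
  (Submodule.span ℝ (testPairs Ω)).topologicalClosure

/-- `K` is an admissible (conformal) triangulation of `Ω`: a finite simplicial complex in which
every face belongs to a `d`-simplex and whose simplices cover exactly the closure of `Ω`.
(That two simplices meet in a common face or not at all is part of the notion of a simplicial
complex.) -/
structure IsTriangulation {d : ℕ} (K : Geometry.SimplicialComplex ℝ (Pt d)) (Ω : Set (Pt d)) :
    Prop where
  finite : K.faces.Finite
  pure : ∀ s ∈ K.faces, ∃ τ ∈ K.faces, s ⊆ τ ∧ τ.card = d + 1
  space_eq : K.space = closure Ω

/-- The finite element space `V_h`: the functions in `H¹₀(Ω)` that coincide on each `d`-simplex of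
the triangulation with a polynomial of (total) degree at most `r`. -/
def feSpace {d : ℕ} (Ω : Set (Pt d)) (K : Geometry.SimplicialComplex ℝ (Pt d)) (r : ℕ) :
    Submodule ℝ (L2 Ω × L2Vec Ω) where
  carrier := {z | z ∈ H10 Ω ∧ ∀ τ ∈ K.faces, τ.card = d + 1 →
    ∃ P : MvPolynomial (Fin d) ℝ, P.totalDegree ≤ r ∧
      ∀ᵐ x ∂(volume.restrict Ω), x ∈ convexHull ℝ (τ : Set (Pt d)) →
        z.1 x = MvPolynomial.eval (fun i => x i) P}
  add_mem' := by
    rintro z w ⟨hz, hz'⟩ ⟨hw, hw'⟩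
    refine ⟨add_mem hz hw, fun τ hτ hc => ?_⟩
    obtain ⟨P, hP, hPz⟩ := hz' τ hτ hc
    obtain ⟨Q, hQ, hQw⟩ := hw' τ hτ hc
    refine ⟨P + Q, (MvPolynomial.totalDegree_add P Q).trans (max_le hP hQ), ?_⟩
    filter_upwards [hPz, hQw, Lp.coeFn_add z.1 w.1] with x h1 h2 h3 hx
    rw [Prod.fst_add, h3, Pi.add_apply, h1 hx, h2 hx, map_add]
  zero_mem' := by
    refine ⟨zero_mem _, fun τ hτ hc => ⟨0, by simp, ?_⟩⟩
    filter_upwards [Lp.coeFn_zero ℝ 2 (volume.restrict Ω)] with x h1 hx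
    rw [Prod.fst_zero, h1, map_zero, Pi.zero_apply]
  smul_mem' := by
    rintro c z ⟨hz, hz'⟩
    refine ⟨Submodule.smul_mem _ c hz, fun τ hτ hc => ?_⟩
    obtain ⟨P, hP, hPz⟩ := hz' τ hτ hc
    refine ⟨c • P, (MvPolynomial.totalDegree_smul_le c P).trans hP, ?_⟩
    filter_upwards [hPz, Lp.coeFn_smul c z.1] with x h1 h3 hx
    rw [Prod.smul_fst, h3, Pi.smul_apply, h1 hx, MvPolynomial.smul_eval, smul_eq_mul]

/-- The assumptions on the coefficients `a_{ij}(t,x)` on `(0,T) × Ω`, with ellipticity constant `α`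
and modulus of continuity `ω` in time. -/
structure CoeffAssumptions {d : ℕ} (T : ℝ) (Ω : Set (Pt d))
    (a : ℝ → Pt d → Matrix (Fin d) (Fin d) ℝ) (α : ℝ) (ω : ℝ → ℝ) : Prop where
  memLp_top : ∀ i j, MemLp (fun z : ℝ × Pt d => a z.1 z.2 i j) ⊤
    ((volume.restrict (Ioo 0 T)).prod (volume.restrict Ω))
  symm : ∀ᵐ z ∂((volume.restrict (Ioo 0 T)).prod (volume.restrict Ω)),
    ∀ i j, a z.1 z.2 i j = a z.1 z.2 j i
  alpha_pos : 0 < α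
  elliptic : ∀ᵐ z ∂((volume.restrict (Ioo 0 T)).prod (volume.restrict Ω)),
    ∀ ξ : Pt d, α * ‖ξ‖ ^ 2 ≤ ∑ i, ∑ j, a z.1 z.2 i j * ξ i * ξ j
  continuous_time : ∀ᵐ x ∂(volume.restrict Ω), ∀ i j,
    ContinuousOn (fun t => a t x i j) (Icc 0 T)
  modulus : ∀ t₁ ∈ Icc 0 T, ∀ t₂ ∈ Icc 0 T, ∀ᵐ x ∂(volume.restrict Ω), ∀ i j,
    |a t₁ x i j - a t₂ x i j| ≤ ω |t₁ - t₂|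
  omega_nonneg : ∀ s ∈ Icc 0 T, 0 ≤ ω s
  omega_mono : MonotoneOn ω (Icc 0 T)
  omega_div_anti : AntitoneOn (fun s => ω s / s ^ (3 / 2 : ℝ)) (Ioc 0 T)
  omega_div_integrable : IntegrableOn (fun s => ω s / s ^ (3 / 2 : ℝ)) (Ioc 0 T)

/-- The bilinear form `a(t; u, v) = ∫_Ω ∑_{i,j} a_{ij}(t,x) ∂_i u ∂_j v dx`, for functions given
together with their gradients. -/
def form {d : ℕ} {Ω : Set (Pt d)} (a : ℝ → Pt d → Matrix (Fin d) (Fin d) ℝ) (t : ℝ)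
    (u v : L2 Ω × L2Vec Ω) : ℝ :=
  ∫ x in Ω, ∑ i, ∑ j, a t x i j * u.2 x i * v.2 x j

/-- A partition `0 = t_0 < t_1 < ⋯ < t_M = T`; only the values `t m` with `m ≤ M` matter. -/
structure TimeMesh (T : ℝ) where
  /-- the number of subintervals -/
  M : ℕ
  one_le_M : 1 ≤ M
  /-- the nodes -/
  t : ℕ → ℝ
  t_zero : t 0 = 0
  t_last : t M = T
  t_lt : ∀ m < M, t m < t (m + 1)

namespace TimeMesh

variable {T : ℝ} (𝒯 : TimeMesh T)

/-- The subinterval `I_m = (t_{m-1}, t_m]`, for `1 ≤ m ≤ M`. -/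
def I (m : ℕ) : Set ℝ := Ioc (𝒯.t (m - 1)) (𝒯.t m)

/-- The step size `k_m = t_m - t_{m-1}`, for `1 ≤ m ≤ M`. -/
def k (m : ℕ) : ℝ := 𝒯.t m - 𝒯.t (m - 1)

/-- The maximal step size `k = max_m k_m`. -/
def kmax : ℝ := (Finset.Icc 1 𝒯.M).sup' (Finset.nonempty_Icc.mpr 𝒯.one_le_M) 𝒯.k

/-- The minimal step size `k_min = min_m k_m`. -/
def kmin : ℝ := (Finset.Icc 1 𝒯.M).inf' (Finset.nonempty_Icc.mpr 𝒯.one_le_M) 𝒯.k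

/-- The conditions on the time mesh, with constants `c`, `β`, `κ`. -/
structure Admissible (c β κ : ℝ) : Prop where
  kmin_ge : c * 𝒯.kmax ^ β ≤ 𝒯.kmin
  ratio : ∀ m ∈ Finset.Icc 1 (𝒯.M - 1),
    κ⁻¹ ≤ 𝒯.k m / 𝒯.k (m + 1) ∧ 𝒯.k m / 𝒯.k (m + 1) ≤ κ
  kmax_le : 𝒯.kmax ≤ T / 4

end TimeMesh

/-- The space of functions of time with values in `V` that are constant on each `I_m`.
The value of such a function `v` on `I_m` is `v (t_m)`. -/
def dgSpace {d : ℕ} {Ω : Set (Pt d)} {T : ℝ} (𝒯 : TimeMesh T)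
    (V : Submodule ℝ (L2 Ω × L2Vec Ω)) : Set (ℝ → L2 Ω × L2Vec Ω) :=
  {v | ∀ m ∈ Finset.Icc 1 𝒯.M, ∃ w ∈ V, ∀ t ∈ 𝒯.I m, v t = w}

/-- The bilinear form `B` on functions that are constant on each `I_m` (on which the term with the
time derivative vanishes):
`B(u,φ) = ∫_I a(t;u,φ) dt + ∑_{m=2}^M ([u]_{m-1}, φ_m)_Ω + (u_1, φ_1)_Ω`. -/
def formB {d : ℕ} {Ω : Set (Pt d)} {T : ℝ} (a : ℝ → Pt d → Matrix (Fin d) (Fin d) ℝ)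
    (𝒯 : TimeMesh T) (u φ : ℝ → L2 Ω × L2Vec Ω) : ℝ :=
  (∫ t in Ioc 0 T, form a t (u t) (φ t)) +
    (∑ m ∈ Finset.Icc 2 𝒯.M,
      inner ℝ ((u (𝒯.t m)).1 - (u (𝒯.t (m - 1))).1) (φ (𝒯.t m)).1) +
    inner ℝ (u (𝒯.t 1)).1 (φ (𝒯.t 1)).1

/-- `u` is the dG(0) approximation with values in `V` to `∂_t u + A(t) u = f`, `u(0) = u₀`, with
homogeneous Dirichlet conditions.  For `V = V_h` this is the dG(0)cG(r) solution. -/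
structure IsDGSolution {d : ℕ} {Ω : Set (Pt d)} {T : ℝ}
    (a : ℝ → Pt d → Matrix (Fin d) (Fin d) ℝ) (𝒯 : TimeMesh T)
    (V : Submodule ℝ (L2 Ω × L2Vec Ω)) (f : ℝ → L2 Ω) (u₀ : L2 Ω)
    (u : ℝ → L2 Ω × L2Vec Ω) : Prop where
  mem : u ∈ dgSpace 𝒯 V
  eq : ∀ φ ∈ dgSpace 𝒯 V,
    formB a 𝒯 u φ = (∫ t in Ioc 0 T, inner ℝ (f t) (φ t).1) + inner ℝ u₀ (φ (𝒯.t 1)).1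

/-- The jump `[u]_{m-1} = u_m - u_{m-1}`, for `1 ≤ m ≤ M`, where `u₀` is the value of `u` to the
left of the first subinterval. -/
def jump {d : ℕ} {Ω : Set (Pt d)} {T : ℝ} (𝒯 : TimeMesh T) (u₀ : L2 Ω)
    (u : ℝ → L2 Ω × L2Vec Ω) (m : ℕ) : L2 Ω :=
  (u (𝒯.t m)).1 - if m = 1 then u₀ else (u (𝒯.t (m - 1))).1

open Classical in
/-- The operator `A_h(t) : V → V` defined by `(A_h(t) v, χ)_Ω = a(t; v, χ)` for all `χ ∈ V`.
For `V = V_h` there is exactly one element of `V` with this property, because `V_h` has finite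
dimension; see `existsUnique_discreteOp`. -/
def discreteOp {d : ℕ} {Ω : Set (Pt d)} (a : ℝ → Pt d → Matrix (Fin d) (Fin d) ℝ)
    (V : Submodule ℝ (L2 Ω × L2Vec Ω)) (t : ℝ) (v : L2 Ω × L2Vec Ω) : L2 Ω × L2Vec Ω :=
  if h : ∃ w ∈ V, ∀ χ ∈ V, inner ℝ w.1 χ.1 = form a t v χ then h.choose else 0

/-- The averaged operator `A_{kh,m} = k_m⁻¹ ∫_{I_m} A_h(t) dt`. -/
def averagedOp {d : ℕ} {Ω : Set (Pt d)} {T : ℝ} (a : ℝ → Pt d → Matrix (Fin d) (Fin d) ℝ)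
    (𝒯 : TimeMesh T) (V : Submodule ℝ (L2 Ω × L2Vec Ω)) (m : ℕ) (v : L2 Ω × L2Vec Ω) :
    L2 Ω × L2Vec Ω :=
  (𝒯.k m)⁻¹ • ∫ t in 𝒯.I m, discreteOp a V t v

/-- The defining property of the weak gradient, tested with `ψ ∈ C_c^∞` in the direction `v`. -/
theorem H10_weak_gradient {d : ℕ} {Ω : Set (Pt d)} {z : L2 Ω × L2Vec Ω} (hz : z ∈ H10 Ω)
    (ψ : Pt d → ℝ) (hψ : ContDiff ℝ (⊤ : ℕ∞) ψ) (hc : HasCompactSupport ψ) (v : Pt d) :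
    (∫ x in Ω, inner ℝ (z.2 x) (ψ x • v)) = -∫ x in Ω, z.1 x * fderiv ℝ ψ x v := by
  have hdc : Continuous (fun x => fderiv ℝ ψ x v) :=
    (hψ.continuous_fderiv (by simp)).clm_apply continuous_const
  have hds : HasCompactSupport (fun x => fderiv ℝ ψ x v) := hc.fderiv_apply ℝ v
  have hPc : Continuous (fun x => ψ x • v) := hψ.continuous.smul continuous_const
  have hP : MemLp (fun x => ψ x • v) 2 (volume.restrict Ω) :=
    (hPc.memLp_of_hasCompactSupport hc.smul_right).restrict Ω
  have hD : MemLp (fun x => fderiv ℝ ψ x v) 2 (volume.restrict Ω) :=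
    (hdc.memLp_of_hasCompactSupport hds).restrict Ω
  have key : ∀ w ∈ H10 Ω, inner ℝ w.2 hP.toLp + inner ℝ w.1 hD.toLp = 0 := by
    let ℓ : (L2 Ω × L2Vec Ω) →L[ℝ] ℝ :=
      (innerSL ℝ hP.toLp).comp (ContinuousLinearMap.snd ℝ (L2 Ω) (L2Vec Ω)) +
        (innerSL ℝ hD.toLp).comp (ContinuousLinearMap.fst ℝ (L2 Ω) (L2Vec Ω))
    have hℓ : ∀ w, ℓ w = inner ℝ w.2 hP.toLp + inner ℝ w.1 hD.toLp := fun w => by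
      simp [ℓ, real_inner_comm]
    have hle : H10 Ω ≤ LinearMap.ker ℓ.toLinearMap := by
      refine Submodule.topologicalClosure_minimal _ (Submodule.span_le.mpr ?_)
        ℓ.isClosed_ker
      rintro w ⟨φ, hφ, hφc, hφs, h1, h2⟩
      have hφd : Differentiable ℝ φ := hφ.differentiable (by simp)
      have hψd : Differentiable ℝ ψ := hψ.differentiable (by simp)
      have hfc : Continuous (fun x => fderiv ℝ φ x v) :=
        (hφ.continuous_fderiv (by simp)).clm_apply continuous_const
      have hfs : HasCompactSupport (fun x => fderiv ℝ φ x v) := hφc.fderiv_apply ℝ v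
      have hz0 : ∀ x, x ∉ Ω → φ x = 0 := fun x hx =>
        image_eq_zero_of_notMem_tsupport (fun h => hx (hφs h))
      have hz1 : ∀ x, x ∉ Ω → fderiv ℝ φ x = 0 := fun x hx => by
        by_contra hne
        exact hx (hφs (support_fderiv_subset ℝ hne))
      have e1 : inner ℝ w.2 hP.toLp = ∫ x, fderiv ℝ φ x v * ψ x := by
        rw [L2.inner_def, ← setIntegral_eq_integral_of_forall_compl_eq_zero (s := Ω)
          (f := fun x => fderiv ℝ φ x v * ψ x) (fun x hx => by simp [hz1 x hx])]
        refine integral_congr_ae ?_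
        filter_upwards [h2, hP.coeFn_toLp] with x hx hx'
        rw [hx, hx', inner_smul_right, mul_comm]
        congr 1
        simp [gradient]
      have e2 : inner ℝ w.1 hD.toLp = ∫ x, φ x * fderiv ℝ ψ x v := by
        rw [L2.inner_def, ← setIntegral_eq_integral_of_forall_compl_eq_zero (s := Ω)
          (f := fun x => φ x * fderiv ℝ ψ x v) (fun x hx => by simp [hz0 x hx])]
        refine integral_congr_ae ?_
        filter_upwards [h1, hD.coeFn_toLp] with x hx hx'
        rw [hx, hx']
        simp [mul_comm]
      have ibp := integral_mul_fderiv_eq_neg_fderiv_mul_of_integrable (μ := volume)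
        (f := φ) (g := ψ) (v := v)
        ((hfc.mul hψ.continuous).integrable_of_hasCompactSupport hfs.mul_right)
        ((hφ.continuous.mul hdc).integrable_of_hasCompactSupport hφc.mul_right)
        ((hφ.continuous.mul hψ.continuous).integrable_of_hasCompactSupport hφc.mul_right)
        (fun x _ => hφd x) (fun x _ => hψd x)
      change ℓ w = 0
      rw [hℓ, e1, e2, ibp]
      ring
    intro w hw
    rw [← hℓ]
    exact hle hw
  have := key z hz
  rw [L2.inner_def, L2.inner_def] at this
  have e1 : (∫ x in Ω, inner ℝ (z.2 x) ((hP.toLp _ : L2Vec Ω) x)) = ∫ x in Ω, inner ℝ (z.2 x) (ψ x • v) := by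
    refine integral_congr_ae ?_
    filter_upwards [hP.coeFn_toLp] with x hx
    rw [hx]
  have e2 : (∫ x in Ω, inner ℝ (z.1 x) ((hD.toLp _ : L2 Ω) x)) = ∫ x in Ω, z.1 x * fderiv ℝ ψ x v := by
    refine integral_congr_ae ?_
    filter_upwards [hD.coeFn_toLp] with x hx
    rw [hx]
    simp [mul_comm]
  rw [e1, e2] at this
  linarith

/-- An element of `H¹₀(Ω)` is determined by its function: the weak gradient is unique. -/
theorem H10_eq_zero {d : ℕ} {Ω : Set (Pt d)} {z : L2 Ω × L2Vec Ω}
    (hz : z ∈ H10 Ω) (h0 : z.1 = 0) : z = 0 := by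
  refine Prod.ext h0 ?_
  rw [Prod.snd_zero, Lp.eq_zero_iff_ae_eq_zero]
  have hi : ∀ i : Fin d, ∀ᵐ x ∂(volume.restrict Ω), z.2 x i = 0 := by
    intro i
    have hloc : LocallyIntegrable (fun x => z.2 x) (volume.restrict Ω) :=
      (Lp.memLp z.2).locallyIntegrable (by norm_num)
    have hli : LocallyIntegrable (fun x => z.2 x i) (volume.restrict Ω) := by
      have hm : MemLp (fun x => z.2 x i) 2 (volume.restrict Ω) :=
        (EuclideanSpace.proj i : Pt d →L[ℝ] ℝ).comp_memLp' (Lp.memLp z.2)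
      exact hm.locallyIntegrable (by norm_num)
    refine ae_eq_zero_of_integral_contDiff_smul_eq_zero hli ?_
    intro g hg hgc
    have := H10_weak_gradient hz g hg hgc (EuclideanSpace.single i 1)
    have hr : (∫ x in Ω, z.1 x * fderiv ℝ g x (EuclideanSpace.single i 1)) = 0 := by
      rw [h0]
      refine integral_eq_zero_of_ae ?_
      filter_upwards [Lp.coeFn_zero ℝ 2 (volume.restrict Ω)] with x hx
      rw [hx]
      simp
    rw [hr, neg_zero] at this
    rw [← this]
    refine integral_congr_ae (Filter.Eventually.of_forall fun x => ?_)
    simp [inner_smul_right, EuclideanSpace.inner_single_right]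
  filter_upwards [ae_all_iff.mpr hi] with x hx
  ext i
  exact hx i

/-- The finite element space has finite dimension. -/
theorem feSpace_finite {d : ℕ} {Ω : Set (Pt d)} (hΩ : IsOpen Ω)
    {K : Geometry.SimplicialComplex ℝ (Pt d)} (hK : IsTriangulation K Ω) (r : ℕ) :
    Module.Finite ℝ (feSpace Ω K r) := by
  let S := {τ : Finset (Pt d) // τ ∈ K.faces ∧ τ.card = d + 1}
  have : Finite S := (hK.finite.subset (fun τ (h : τ ∈ K.faces ∧ τ.card = d + 1) => h.1)).to_subtype
  let W : Submodule ℝ (feSpace Ω K r × (S → MvPolynomial.restrictTotalDegree (Fin d) ℝ r)) :=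
    { carrier := {y | ∀ τ : S, ∀ᵐ x ∂(volume.restrict Ω),
        x ∈ convexHull ℝ (τ.1 : Set (Pt d)) →
          y.1.1.1 x = MvPolynomial.eval (fun i => x i) (y.2 τ).1}
      add_mem' := by
        intro y y' h h' τ
        filter_upwards [h τ, h' τ, Lp.coeFn_add y.1.1.1 y'.1.1.1] with x h1 h2 h3 hx
        have e : (y + y').1.1.1 = y.1.1.1 + y'.1.1.1 := rfl
        have e' : ((y + y').2 τ).1 = (y.2 τ).1 + (y'.2 τ).1 := rfl
        rw [e, e', h3, Pi.add_apply, h1 hx, h2 hx, map_add]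
      zero_mem' := by
        intro τ
        filter_upwards [Lp.coeFn_zero ℝ 2 (volume.restrict Ω)] with x h1 hx
        have e : (0 : feSpace Ω K r × (S → MvPolynomial.restrictTotalDegree (Fin d) ℝ r)).1.1.1 = 0 := rfl
        have e' : ((0 : feSpace Ω K r × (S → MvPolynomial.restrictTotalDegree (Fin d) ℝ r)).2 τ).1 = 0 := rfl
        rw [e, e', h1, map_zero, Pi.zero_apply]
      smul_mem' := by
        intro c y h τ
        filter_upwards [h τ, Lp.coeFn_smul c y.1.1.1] with x h1 h3 hx
        have e : (c • y).1.1.1 = c • y.1.1.1 := rfl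
        have e' : ((c • y).2 τ).1 = c • (y.2 τ).1 := rfl
        rw [e, e', h3, Pi.smul_apply, h1 hx, MvPolynomial.smul_eval, smul_eq_mul] }
  let π₂ : W →ₗ[ℝ] (S → MvPolynomial.restrictTotalDegree (Fin d) ℝ r) := (LinearMap.snd ℝ _ _).comp W.subtype
  let π₁ : W →ₗ[ℝ] feSpace Ω K r := (LinearMap.fst ℝ _ _).comp W.subtype
  have hinj : Function.Injective π₂ := by
    rintro ⟨⟨y, q⟩, hy⟩ ⟨⟨y', q'⟩, hy'⟩ h
    have hq : q = q' := h
    subst hq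
    have he : y.1.1 = y'.1.1 := by
      refine Lp.ext ?_
      have hΩm : ∀ᵐ x ∂(volume.restrict Ω), x ∈ Ω := ae_restrict_mem hΩ.measurableSet
      filter_upwards [ae_all_iff.mpr hy, ae_all_iff.mpr hy', hΩm] with x hx hx' hxΩ
      have hxs : x ∈ K.space := hK.space_eq ▸ subset_closure hxΩ
      obtain ⟨s, hs, hxs⟩ := Geometry.SimplicialComplex.mem_space_iff.mp hxs
      obtain ⟨τ, hτ, hsτ, hcard⟩ := hK.pure s hs
      have hm := convexHull_mono (𝕜 := ℝ) (by exact_mod_cast hsτ) hxs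
      exact (hx ⟨τ, hτ, hcard⟩ hm).trans (hx' ⟨τ, hτ, hcard⟩ hm).symm
    have hz : y.1 - y'.1 = 0 :=
      H10_eq_zero (sub_mem y.2.1 y'.2.1) (by rw [Prod.fst_sub, he, sub_self])
    have : y = y' := Subtype.ext (sub_eq_zero.mp hz)
    subst this
    rfl
  have hsurj : Function.Surjective π₁ := by
    intro y
    choose! P hP hPy using y.2.2
    refine ⟨⟨⟨y, fun τ => ⟨P τ.1,
      (MvPolynomial.mem_restrictTotalDegree (Fin d) r (P τ.1)).mpr (hP τ.1 τ.2.1 τ.2.2)⟩⟩,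
      fun τ => hPy τ.1 τ.2.1 τ.2.2⟩, rfl⟩
  have : Module.Finite ℝ W := Module.Finite.of_injective π₂ hinj
  exact Module.Finite.of_surjective π₁ hsurj

/-- Riesz representation in the finite element space with the `L²(Ω)` inner product. -/
theorem feSpace_riesz {d : ℕ} {Ω : Set (Pt d)} (hΩ : IsOpen Ω)
    {K : Geometry.SimplicialComplex ℝ (Pt d)} (hK : IsTriangulation K Ω) (r : ℕ)
    (ℓ : feSpace Ω K r →ₗ[ℝ] ℝ) :
    ∃! w : feSpace Ω K r, ∀ χ : feSpace Ω K r, inner ℝ w.1.1 χ.1.1 = ℓ χ := by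
  have := feSpace_finite hΩ hK r
  let p : feSpace Ω K r →ₗ[ℝ] L2 Ω := (LinearMap.fst ℝ _ _).comp (feSpace Ω K r).subtype
  let J : feSpace Ω K r →ₗ[ℝ] (feSpace Ω K r →ₗ[ℝ] ℝ) := (innerₗ (L2 Ω)).compl₁₂ p p
  have hJ : ∀ w χ, J w χ = inner ℝ w.1.1 χ.1.1 := fun w χ => rfl
  have hinj : Function.Injective J := by
    rw [← LinearMap.ker_eq_bot, LinearMap.ker_eq_bot']
    intro w hw
    have h1 : inner ℝ w.1.1 w.1.1 = 0 := by rw [← hJ, hw]; rfl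
    exact Subtype.ext (H10_eq_zero w.2.1 (inner_self_eq_zero.mp h1))
  have hsurj : Function.Surjective J :=
    (LinearMap.injective_iff_surjective_of_finrank_eq_finrank
      (Subspace.dual_finrank_eq (K := ℝ) (V := feSpace Ω K r)).symm).mp hinj
  obtain ⟨w, hw⟩ := hsurj ℓ
  refine ⟨w, fun χ => by rw [← hw, hJ], fun w' hw' => hinj ?_⟩
  rw [hw]
  exact LinearMap.ext fun χ => by rw [hJ, hw']

/-- The integrand of the bilinear form is integrable if the coefficients are in `L^∞(Ω)`. -/
theorem integrable_form {d : ℕ} {Ω : Set (Pt d)} (a : ℝ → Pt d → Matrix (Fin d) (Fin d) ℝ) (t : ℝ)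
    (ha : ∀ i j, MemLp (fun x => a t x i j) ⊤ (volume.restrict Ω)) (u v : L2 Ω × L2Vec Ω) :
    Integrable (fun x => ∑ i, ∑ j, a t x i j * u.2 x i * v.2 x j) (volume.restrict Ω) := by
  have hm : ∀ (w : L2Vec Ω) (i : Fin d), MemLp (fun x => w x i) 2 (volume.restrict Ω) :=
    fun w i => (EuclideanSpace.proj i : Pt d →L[ℝ] ℝ).comp_memLp' (Lp.memLp w)
  refine integrable_finsetSum _ fun i _ => integrable_finsetSum _ fun j _ => ?_
  have h2 : MemLp (fun x => a t x i j * u.2 x i) 2 (volume.restrict Ω) :=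
    MemLp.mul (hm u.2 i) (ha i j)
  exact MemLp.integrable_mul h2 (hm v.2 j)

/-- The operator `A_h(t)` on the finite element space is well defined by its variational
equation. -/
theorem existsUnique_discreteOp {d : ℕ} {Ω : Set (Pt d)} (hΩ : IsOpen Ω)
    {K : Geometry.SimplicialComplex ℝ (Pt d)} (hK : IsTriangulation K Ω) (r : ℕ)
    (a : ℝ → Pt d → Matrix (Fin d) (Fin d) ℝ) (t : ℝ)
    (ha : ∀ i j, MemLp (fun x => a t x i j) ⊤ (volume.restrict Ω)) (v : L2 Ω × L2Vec Ω) :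
    ∃! w : feSpace Ω K r, ∀ χ ∈ feSpace Ω K r, inner ℝ w.1.1 χ.1 = form a t v χ := by
  let ℓ : feSpace Ω K r →ₗ[ℝ] ℝ :=
    { toFun := fun χ => form a t v χ.1
      map_add' := by
        intro χ χ'
        rw [form, form, form,
          ← integral_add (integrable_form a t ha v χ.1) (integrable_form a t ha v χ'.1)]
        refine integral_congr_ae ?_
        filter_upwards [Lp.coeFn_add χ.1.2 χ'.1.2] with x hx
        have e : (χ + χ').1.2 = χ.1.2 + χ'.1.2 := rfl
        rw [e, hx]
        simp only [Pi.add_apply, PiLp.add_apply, mul_add, Finset.sum_add_distrib]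
      map_smul' := by
        intro c χ
        rw [RingHom.id_apply, smul_eq_mul, form, form, ← integral_const_mul]
        refine integral_congr_ae ?_
        filter_upwards [Lp.coeFn_smul c χ.1.2] with x hx
        have e : (c • χ).1.2 = c • χ.1.2 := rfl
        rw [e, hx]
        simp only [Pi.smul_apply, PiLp.smul_apply, smul_eq_mul, Finset.mul_sum]
        refine Finset.sum_congr rfl fun i _ => Finset.sum_congr rfl fun j _ => ?_
        ring }
  obtain ⟨w, hw, hu⟩ := feSpace_riesz hΩ hK r ℓ
  exact ⟨w, fun χ hχ => hw ⟨χ, hχ⟩, fun w' hw' => hu w' fun χ => hw' χ.1 χ.2⟩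

end DGMaxReg

end

open DGMaxReg

open MeasureTheory Set

noncomputable section

namespace DGMaxReg

/-! Testing the dG(0) equation on one interval at a time turns it into an implicit Euler scheme `u_j
- u_{j-1} + k_j A_j u_j = k_j f_j` on a finite-dimensional space of `L²` functions. Here `A_j`
represents the form averaged over `I_j`, and `f_j` is the `L²` projection of the average of `f`
(`IsDGSolution.step`).

To bound `A_m u_m`, freeze the operator at the final step `m` (`norm_apply_le`). The scheme then has
the single symmetric operator `A_m` and the right-hand side `f_j + (A_m - A_j) u_j`, so it is solved
explicitly in an eigenbasis of `A_m`. With `τ = t_m - t_{l-1}`, the multiplier `λ / ∏_{j=l}^m (1 +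
k_j λ)` is at most `1/τ`. The perturbation is only bounded in the dual of the energy norm, with
factor `ω(τ)`. This costs another `λ^{1/2}`, and `cube_le_prod_sq` with `norm_le_of_energy_bound`
gives the decay `τ^{-3/2}`.

Hence `‖A_m u_m‖` is at most `‖f_m‖` plus a discrete convolution of `‖f_l‖` with `1/τ` plus one of
the energy norms of `u_l` with `ω(τ) τ^{-3/2}`. Schur's test (`wnorm_strict_kernel_le`) bounds them
for all `p` at once: the first kernel costs a logarithm, the second a constant `Z`. The energy norm
is interpolated between `‖A_m u_m‖` and `‖u_m‖`; the former part is absorbed and the latter is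
controlled by stability. This is `discrete_maximal_regularity`. The jumps follow from the scheme
itself. Nothing depends on the space beyond its finite dimension. -/

/-! ### Scalar recursions and sums over a grid. -/

/-- A product of factors `1 + k_j x` dominates its expansion up to second order. -/
theorem one_add_sum_add_le_prod {ι : Type*} (S : Finset ι) (k : ι → ℝ) (x : ℝ) (hx : 0 ≤ x)
    (hk : ∀ j ∈ S, 0 ≤ k j) :
    ∑ j ∈ S, k j ^ 2 ≤ (∑ j ∈ S, k j) ^ 2 ∧
    1 + x * ∑ j ∈ S, k j + x ^ 2 * (((∑ j ∈ S, k j) ^ 2 - ∑ j ∈ S, k j ^ 2) / 2) ≤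
      ∏ j ∈ S, (1 + k j * x) := by
  classical
  induction S using Finset.induction_on with
  | empty => simp
  | insert a S ha ih =>
    obtain ⟨h1, h2⟩ := ih fun j hj => hk j (Finset.mem_insert_of_mem hj)
    have hka := hk a (Finset.mem_insert_self a S)
    have hs : 0 ≤ ∑ j ∈ S, k j :=
      Finset.sum_nonneg fun j hj => hk j (Finset.mem_insert_of_mem hj)
    rw [Finset.sum_insert ha, Finset.sum_insert ha, Finset.prod_insert ha]
    set σ := ∑ j ∈ S, k j
    set q := ∑ j ∈ S, k j ^ 2
    have hm := mul_nonneg hka hs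
    refine ⟨by nlinarith, ?_⟩
    have h3 := mul_le_mul_of_nonneg_left h2 (by positivity : 0 ≤ 1 + k a * x)
    refine le_trans ?_ h3
    -- The third-order term of the new product is dropped. Its sign comes from `q ≤ σ ^ 2`, which is
    -- why that inequality is part of the induction.
    have h4 : 0 ≤ k a * x * (x ^ 2 * ((σ ^ 2 - q) / 2)) :=
      mul_nonneg (by positivity) (mul_nonneg (by positivity) (by linarith))
    nlinarith

theorem sum_Icc_sub_pred (t : ℕ → ℝ) {l m : ℕ} (hlm : l ≤ m) :
    ∑ j ∈ Finset.Icc l m, (t j - t (j - 1)) = t m - t (l - 1) := by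
  induction m, hlm using Nat.le_induction with
  | base => simp
  | succ m hm ih =>
    rw [Finset.sum_Icc_succ_top (by omega), ih]
    simp

/-- The solution of a scalar implicit Euler recursion. -/
theorem implicit_euler_formula (k g y : ℕ → ℝ) (x : ℝ) (m : ℕ) (hy0 : y 0 = 0)
    (hpos : ∀ j ∈ Finset.Icc 1 m, 0 < 1 + k j * x)
    (hy : ∀ j ∈ Finset.Icc 1 m, (1 + k j * x) * y j = y (j - 1) + k j * g j) :
    y m = ∑ l ∈ Finset.Icc 1 m, k l * (g l / ∏ j ∈ Finset.Icc l m, (1 + k j * x)) := by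
  induction m with
  | zero => simp [hy0]
  | succ m ih =>
    have h1 := hpos (m + 1) (by simp)
    have h2 := hy (m + 1) (by simp)
    rw [Nat.add_sub_cancel, ih
      (fun j hj => hpos j (Finset.Icc_subset_Icc_right (by omega) hj))
      (fun j hj => hy j (Finset.Icc_subset_Icc_right (by omega) hj))] at h2
    rw [Finset.sum_Icc_succ_top (by omega), Finset.Icc_self, Finset.prod_singleton]
    have h3 : ∑ l ∈ Finset.Icc 1 m, k l * (g l / ∏ j ∈ Finset.Icc l (m + 1), (1 + k j * x)) =
        (∑ l ∈ Finset.Icc 1 m, k l * (g l / ∏ j ∈ Finset.Icc l m, (1 + k j * x))) /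
          (1 + k (m + 1) * x) := by
      rw [Finset.sum_div]
      refine Finset.sum_congr rfl fun l hl => ?_
      rw [Finset.prod_Icc_succ_top (by simp at hl; omega)]
      rw [← div_div, mul_div_assoc]
    rw [h3, ← mul_div_assoc, ← add_div, ← h2]
    field_simp

/-- Row sums of a decreasing kernel on a grid are bounded by differences of a primitive. -/
theorem sum_row_le (t : ℕ → ℝ) (κ Φ : ℝ → ℝ) (m : ℕ) (hm : 1 ≤ m)
    (h : ∀ l ∈ Finset.Ico 1 m,
      (t l - t (l - 1)) * κ (t m - t (l - 1)) ≤ Φ (t m - t (l - 1)) - Φ (t m - t l)) :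
    ∑ l ∈ Finset.Ico 1 m, (t l - t (l - 1)) * κ (t m - t (l - 1)) ≤
      Φ (t m - t 0) - Φ (t m - t (m - 1)) := by
  refine (Finset.sum_le_sum h).trans (le_of_eq ?_)
  obtain ⟨n, rfl⟩ : ∃ n, m = n + 1 := ⟨m - 1, by omega⟩
  rw [Finset.sum_Ico_eq_sum_range]
  simp only [Nat.add_sub_cancel, add_comm 1]
  rw [Finset.sum_range_sub' (fun l => Φ (t (n + 1) - t l))]

/-- Column sums of a decreasing kernel on a grid are bounded by differences of a primitive. -/
theorem sum_col_le (t : ℕ → ℝ) (κ Φ : ℝ → ℝ) (l M : ℕ) (hlM : l ≤ M)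
    (h : ∀ m ∈ Finset.Ioc l M,
      (t m - t (m - 1)) * κ (t m - t (l - 1)) ≤
        Φ (t m - t (l - 1)) - Φ (t (m - 1) - t (l - 1))) :
    ∑ m ∈ Finset.Ioc l M, (t m - t (m - 1)) * κ (t m - t (l - 1)) ≤
      Φ (t M - t (l - 1)) - Φ (t l - t (l - 1)) := by
  refine (Finset.sum_le_sum h).trans (le_of_eq ?_)
  clear h
  induction M, hlM using Nat.le_induction with
  | base => simp
  | succ M hM ih => rw [Finset.sum_Ioc_succ_top (by omega), ih]; simp

/-! ### Multipliers in an eigenbasis. -/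

theorem norm_le_of_abs_inner_le {E ι : Type*} [NormedAddCommGroup E] [InnerProductSpace ℝ E]
    [Fintype ι] (b : OrthonormalBasis ι ℝ E) {z v : E} {B : ℝ} (hB : 0 ≤ B)
    (h : ∀ i, |inner ℝ (b i) z| ≤ B * |inner ℝ (b i) v|) : ‖z‖ ≤ B * ‖v‖ := by
  refine le_of_sq_le_sq ?_ (by positivity)
  rw [mul_pow, ← b.sum_sq_norm_inner_right z, ← b.sum_sq_norm_inner_right v, Finset.mul_sum]
  refine Finset.sum_le_sum fun i _ => ?_
  rw [← mul_pow]
  exact pow_le_pow_left₀ (norm_nonneg _) (h i) 2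

/-- A multiplier in an eigenbasis, applied to a functional that is bounded in the energy norm. -/
theorem norm_le_of_energy_bound {E ι : Type*} [NormedAddCommGroup E] [InnerProductSpace ℝ E]
    [Fintype ι] (b : OrthonormalBasis ι ℝ E) (A : E →ₗ[ℝ] E) (lam φ : ι → ℝ)
    (hA : ∀ i, A (b i) = lam i • b i)
    (N : E → ℝ) {α D W : ℝ} (hα : 0 < α) (hD : 0 ≤ D) (hW : 0 ≤ W)
    (hN : ∀ v, α * N v ^ 2 ≤ inner ℝ (A v) v)
    (hφ : ∀ i, lam i * φ i ^ 2 ≤ D) {g z : E} (hg : ∀ w, inner ℝ g w ≤ W * N w)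
    (hz : ∀ i, inner ℝ (b i) z = φ i * inner ℝ (b i) g) : ‖z‖ ≤ W * √(D / α) := by
  -- Duality: `y = φ(A) z` and `z = φ(A) g` give `‖z‖² = ⟨g, y⟩ ≤ W * N y`, while the energy of `y`
  -- is at most `D ‖z‖²`.
  let y : E := ∑ i, (φ i * inner ℝ (b i) z) • b i
  have hy : ∀ i, inner ℝ (b i) y = φ i * inner ℝ (b i) z := fun i => by
    simp only [y]
    rw [b.orthonormal.inner_right_fintype]
  have h1 : ‖z‖ ^ 2 = inner ℝ g y := by
    rw [← b.sum_inner_mul_inner g y, ← b.sum_sq_norm_inner_right z]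
    refine Finset.sum_congr rfl fun i _ => ?_
    rw [hy, Real.norm_eq_abs, sq_abs, real_inner_comm (b i) g, hz i]
    ring
  have h2 : inner ℝ (A y) y ≤ D * ‖z‖ ^ 2 := by
    have : A y = ∑ i, (φ i * inner ℝ (b i) z) • lam i • b i := by
      simp only [y, map_sum, map_smul, hA]
    rw [this, sum_inner, ← b.sum_sq_norm_inner_right z, Finset.mul_sum]
    refine Finset.sum_le_sum fun i _ => ?_
    rw [real_inner_smul_left, real_inner_smul_left, hy, Real.norm_eq_abs, sq_abs]
    have := mul_le_mul_of_nonneg_right (hφ i) (sq_nonneg (inner ℝ (b i) z))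
    linarith
  have h3 : N y ≤ √(D / α) * ‖z‖ := by
    refine le_of_sq_le_sq ?_ (by positivity)
    rw [mul_pow, Real.sq_sqrt (by positivity), div_mul_eq_mul_div, le_div_iff₀ hα]
    linarith [hN y]
  have h4 : ‖z‖ ^ 2 ≤ W * √(D / α) * ‖z‖ := by
    rw [h1, mul_assoc]
    exact (hg y).trans (mul_le_mul_of_nonneg_left h3 hW)
  rcases (norm_nonneg z).eq_or_lt with h | h
  · rw [← h]; positivity
  · rw [sq] at h4
    exact le_of_mul_le_mul_right h4 h

/-! ### Weighted `ℓ^p` norms and Schur's test. -/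

/-- The weighted `ℓ^p` norm with weights `w`. -/
def wnorm (s : Finset ℕ) (w : ℕ → ℝ) (p : ℝ) (x : ℕ → ℝ) : ℝ := (∑ i ∈ s, w i * x i ^ p) ^ (1 / p)

section wnorm

variable {s : Finset ℕ} {w : ℕ → ℝ} {p : ℝ}

theorem wnorm_nonneg (hw : ∀ i ∈ s, 0 ≤ w i) {x : ℕ → ℝ} (hx : ∀ i ∈ s, 0 ≤ x i) :
    0 ≤ wnorm s w p x :=
  Real.rpow_nonneg (Finset.sum_nonneg fun i hi =>
    mul_nonneg (hw i hi) (Real.rpow_nonneg (hx i hi) _)) _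

theorem wnorm_mono (hw : ∀ i ∈ s, 0 ≤ w i) (hp : 1 ≤ p) {x y : ℕ → ℝ} (hx : ∀ i ∈ s, 0 ≤ x i)
    (hxy : ∀ i ∈ s, x i ≤ y i) : wnorm s w p x ≤ wnorm s w p y := by
  refine Real.rpow_le_rpow (Finset.sum_nonneg fun i hi =>
    mul_nonneg (hw i hi) (Real.rpow_nonneg (hx i hi) _)) ?_ (by positivity)
  exact Finset.sum_le_sum fun i hi => mul_le_mul_of_nonneg_left
    (Real.rpow_le_rpow (hx i hi) (hxy i hi) (by linarith)) (hw i hi)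

theorem wnorm_add_le (hw : ∀ i ∈ s, 0 ≤ w i) (hp : 1 ≤ p) {x y : ℕ → ℝ}
    (hx : ∀ i ∈ s, 0 ≤ x i) (hy : ∀ i ∈ s, 0 ≤ y i) :
    wnorm s w p (fun i => x i + y i) ≤ wnorm s w p x + wnorm s w p y := by
  have hp0 : p ≠ 0 := by positivity
  have key : ∀ z : ℕ → ℝ, (∀ i ∈ s, 0 ≤ z i) →
      wnorm s w p z = (∑ i ∈ s, (w i ^ (1 / p) * z i) ^ p) ^ (1 / p) := by
    intro z hz
    unfold wnorm
    congr 1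
    refine Finset.sum_congr rfl fun i hi => ?_
    rw [Real.mul_rpow (Real.rpow_nonneg (hw i hi) _) (hz i hi), ← Real.rpow_mul (hw i hi),
      one_div_mul_cancel hp0, Real.rpow_one]
  rw [key x hx, key y hy, key _ fun i hi => add_nonneg (hx i hi) (hy i hi)]
  simp only [mul_add]
  exact Real.Lp_add_le_of_nonneg s hp
    (fun i hi => mul_nonneg (Real.rpow_nonneg (hw i hi) _) (hx i hi))
    (fun i hi => mul_nonneg (Real.rpow_nonneg (hw i hi) _) (hy i hi))

theorem wnorm_mul (hw : ∀ i ∈ s, 0 ≤ w i) (hp : 1 ≤ p) {c : ℝ} (hc : 0 ≤ c) {x : ℕ → ℝ}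
    (hx : ∀ i ∈ s, 0 ≤ x i) : wnorm s w p (fun i => c * x i) = c * wnorm s w p x := by
  have hp0 : p ≠ 0 := by positivity
  have : ∑ i ∈ s, w i * (c * x i) ^ p = c ^ p * ∑ i ∈ s, w i * x i ^ p := by
    rw [Finset.mul_sum]
    refine Finset.sum_congr rfl fun i hi => ?_
    rw [Real.mul_rpow hc (hx i hi)]
    ring
  rw [wnorm, this, Real.mul_rpow (Real.rpow_nonneg hc _) (Finset.sum_nonneg fun i hi =>
    mul_nonneg (hw i hi) (Real.rpow_nonneg (hx i hi) _)), ← Real.rpow_mul hc,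
    mul_one_div_cancel hp0, Real.rpow_one, wnorm]

/-- Schur's test in a weighted `ℓ^p` space. -/
theorem wnorm_kernel_le (hw : ∀ i ∈ s, 0 ≤ w i) (hp : 1 ≤ p) (k : ℕ → ℕ → ℝ)
    (hk : ∀ i ∈ s, ∀ j ∈ s, 0 ≤ k i j) {B : ℝ} (hB : 0 ≤ B)
    (hrow : ∀ i ∈ s, ∑ j ∈ s, w j * k i j ≤ B) (hcol : ∀ j ∈ s, ∑ i ∈ s, w i * k i j ≤ B)
    {x : ℕ → ℝ} (hx : ∀ i ∈ s, 0 ≤ x i) :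
    wnorm s w p (fun i => ∑ j ∈ s, w j * k i j * x j) ≤ B * wnorm s w p x := by
  have hp0 : p ≠ 0 := by positivity
  have hpp : 0 < p := by positivity
  have hwk : ∀ i ∈ s, ∀ j ∈ s, 0 ≤ w j * k i j := fun i hi j hj =>
    mul_nonneg (hw j hj) (hk i hi j hj)
  have hS : ∀ i ∈ s, 0 ≤ ∑ j ∈ s, w j * k i j * x j ^ p := fun i hi =>
    Finset.sum_nonneg fun j hj => mul_nonneg (hwk i hi j hj) (Real.rpow_nonneg (hx j hj) _)
  have h1 : ∀ i ∈ s, (∑ j ∈ s, w j * k i j * x j) ^ p ≤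
      B ^ (p - 1) * ∑ j ∈ s, w j * k i j * x j ^ p := by
    intro i hi
    -- Hölder with the row as weight. Both factors are extended by zero because their signs are
    -- known only on `s`.
    have h := Real.inner_le_weight_mul_Lp_of_nonneg s hp
      (fun j => if j ∈ s then w j * k i j else 0) (fun j => if j ∈ s then x j else 0)
      (fun j => by split_ifs with h; exacts [hwk i hi j h, le_rfl])
      (fun j => by split_ifs with h; exacts [hx j h, le_rfl])
    have e1 : ∑ j ∈ s, (if j ∈ s then w j * k i j else 0) * (if j ∈ s then x j else 0) =
        ∑ j ∈ s, w j * k i j * x j := Finset.sum_congr rfl fun j hj => by simp [hj]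
    have e2 : ∑ j ∈ s, (if j ∈ s then w j * k i j else 0) =
        ∑ j ∈ s, w j * k i j := Finset.sum_congr rfl fun j hj => by simp [hj]
    have e3 : ∑ j ∈ s, (if j ∈ s then w j * k i j else 0) * (if j ∈ s then x j else 0) ^ p =
        ∑ j ∈ s, w j * k i j * x j ^ p := Finset.sum_congr rfl fun j hj => by simp [hj]
    rw [e1, e2, e3] at h
    have h0 : 0 ≤ ∑ j ∈ s, w j * k i j := Finset.sum_nonneg (hwk i hi)
    have hp1 : 0 ≤ 1 - p⁻¹ := by
      rw [sub_nonneg]; exact inv_le_one_of_one_le₀ hp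
    calc (∑ j ∈ s, w j * k i j * x j) ^ p
        ≤ (B ^ (1 - p⁻¹) * (∑ j ∈ s, w j * k i j * x j ^ p) ^ p⁻¹) ^ p := by
          refine Real.rpow_le_rpow (Finset.sum_nonneg fun j hj =>
            mul_nonneg (hwk i hi j hj) (hx j hj)) (h.trans ?_) hpp.le
          exact mul_le_mul_of_nonneg_right (Real.rpow_le_rpow h0 (hrow i hi) hp1)
            (Real.rpow_nonneg (hS i hi) _)
      _ = _ := by
          rw [Real.mul_rpow (Real.rpow_nonneg hB _) (Real.rpow_nonneg (hS i hi) _),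
            ← Real.rpow_mul hB, ← Real.rpow_mul (hS i hi), inv_mul_cancel₀ hp0, Real.rpow_one,
            sub_mul, inv_mul_cancel₀ hp0, one_mul]
  have h2 : ∑ i ∈ s, w i * (∑ j ∈ s, w j * k i j * x j) ^ p ≤ B ^ p * ∑ j ∈ s, w j * x j ^ p := by
    calc _ ≤ ∑ i ∈ s, w i * (B ^ (p - 1) * ∑ j ∈ s, w j * k i j * x j ^ p) :=
          Finset.sum_le_sum fun i hi => mul_le_mul_of_nonneg_left (h1 i hi) (hw i hi)
      _ = B ^ (p - 1) * ∑ j ∈ s, (∑ i ∈ s, w i * k i j) * (w j * x j ^ p) := by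
          simp only [Finset.mul_sum, Finset.sum_mul]
          rw [Finset.sum_comm]
          refine Finset.sum_congr rfl fun i _ => Finset.sum_congr rfl fun j _ => ?_
          ring
      _ ≤ B ^ (p - 1) * ∑ j ∈ s, B * (w j * x j ^ p) := by
          refine mul_le_mul_of_nonneg_left (Finset.sum_le_sum fun j hj => ?_)
            (Real.rpow_nonneg hB _)
          exact mul_le_mul_of_nonneg_right (hcol j hj)
            (mul_nonneg (hw j hj) (Real.rpow_nonneg (hx j hj) _))
      _ = _ := by
          rw [← Finset.mul_sum, ← mul_assoc]
          congr 1
          rcases hB.eq_or_lt with h | h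
          · rw [← h, mul_zero, Real.zero_rpow hp0]
          · rw [Real.rpow_sub_one h.ne']; field_simp
  have hx' : 0 ≤ ∑ j ∈ s, w j * x j ^ p :=
    Finset.sum_nonneg fun j hj => mul_nonneg (hw j hj) (Real.rpow_nonneg (hx j hj) _)
  calc wnorm s w p _ ≤ (B ^ p * ∑ j ∈ s, w j * x j ^ p) ^ (1 / p) := by
        refine Real.rpow_le_rpow (Finset.sum_nonneg fun i hi => mul_nonneg (hw i hi)
          (Real.rpow_nonneg (Finset.sum_nonneg fun j hj =>
            mul_nonneg (hwk i hi j hj) (hx j hj)) _)) h2 (by positivity)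
    _ = _ := by
        rw [Real.mul_rpow (Real.rpow_nonneg hB _) hx', ← Real.rpow_mul hB,
          mul_one_div_cancel hp0, Real.rpow_one, wnorm]

end wnorm

/-! ### Decay of resolvent products and the frozen operator. -/

/-- Keeps only the linear term of the expansion. With `x` an eigenvalue it is the smoothing bound
`1/τ` for one power of the operator. -/
theorem mul_sub_le_prod (t : ℕ → ℝ) {l m : ℕ} (hlm : l ≤ m)
    (hk : ∀ j ∈ Finset.Icc l m, 0 < t j - t (j - 1)) {x : ℝ} (hx : 0 ≤ x) :
    x * (t m - t (l - 1)) ≤ ∏ j ∈ Finset.Icc l m, (1 + (t j - t (j - 1)) * x) := by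
  obtain ⟨h1, h2⟩ := one_add_sum_add_le_prod (Finset.Icc l m) (fun j => t j - t (j - 1)) x hx
    fun j hj => (hk j hj).le
  rw [sum_Icc_sub_pred t hlm] at h1 h2
  have := mul_nonneg (sq_nonneg x) (sub_nonneg.mpr h1)
  linarith

/-- With at least two steps of comparable sizes, the product grows at least like the power `3/2`. -/
theorem cube_le_prod_sq (t : ℕ → ℝ) {l m : ℕ} (hlm : l < m)
    (hk : ∀ j ∈ Finset.Icc l m, 0 < t j - t (j - 1)) {κ : ℝ} (hκ : 0 < κ)
    (hr : ∀ j ∈ Finset.Ico l m, t j - t (j - 1) ≤ κ * (t (j + 1) - t j) ∧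
      t (j + 1) - t j ≤ κ * (t j - t (j - 1))) {x : ℝ} (hx : 0 ≤ x) :
    (x * (t m - t (l - 1))) ^ 3 ≤
      2 * (1 + κ) * (∏ j ∈ Finset.Icc l m, (1 + (t j - t (j - 1)) * x)) ^ 2 := by
  obtain ⟨h1, h2⟩ := one_add_sum_add_le_prod (Finset.Icc l m) (fun j => t j - t (j - 1)) x hx
    fun j hj => (hk j hj).le
  have hsum := sum_Icc_sub_pred t hlm.le
  have hτ : 0 ≤ t m - t (l - 1) := hsum ▸ Finset.sum_nonneg fun j hj => (hk j hj).le
  rw [hsum] at h1 h2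
  set τ := t m - t (l - 1)
  set P := ∏ j ∈ Finset.Icc l m, (1 + (t j - t (j - 1)) * x)
  have hpair : ∀ i ∈ Finset.Icc l m, ∀ j ∈ Finset.Icc l m, i ≠ j →
      (t i - t (i - 1)) + (t j - t (j - 1)) ≤ τ := by
    intro i hi j hj hij
    rw [← hsum, ← Finset.sum_pair (f := fun j => t j - t (j - 1)) hij]
    exact Finset.sum_le_sum_of_subset_of_nonneg
      (by intro a ha; rw [Finset.mem_insert, Finset.mem_singleton] at ha
          rcases ha with rfl | rfl <;> assumption) fun j hj _ => (hk j hj).le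
  -- No single step fills the window: each has a neighbour inside it that is at least `1/κ` times as
  -- long. For `j = m` this is the left neighbour, available because `l < m`. Consequently the
  -- second-order coefficient of the product is comparable with `τ ^ 2`.
  have hstep : ∀ j ∈ Finset.Icc l m, (1 + κ) * (t j - t (j - 1)) ≤ κ * τ := by
    intro j hj
    rw [Finset.mem_Icc] at hj
    rcases hj.2.lt_or_eq with h | h
    · have h3 := hpair j (Finset.mem_Icc.mpr hj) (j + 1) (by rw [Finset.mem_Icc]; omega) (by omega)
      have h4 := (hr j (by rw [Finset.mem_Ico]; omega)).1
      rw [Nat.add_sub_cancel] at h3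
      nlinarith
    · have h3 := hpair j (Finset.mem_Icc.mpr hj) (j - 1) (by rw [Finset.mem_Icc]; omega) (by omega)
      have h4 := (hr (j - 1) (by rw [Finset.mem_Ico]; omega)).2
      rw [show j - 1 + 1 = j by omega] at h4
      nlinarith
  have hq : (1 + κ) * ∑ j ∈ Finset.Icc l m, (t j - t (j - 1)) ^ 2 ≤ κ * τ ^ 2 := by
    have e : κ * τ ^ 2 = ∑ j ∈ Finset.Icc l m, κ * τ * (t j - t (j - 1)) := by
      rw [← Finset.mul_sum, hsum]; ring
    rw [e, Finset.mul_sum]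
    refine Finset.sum_le_sum fun j hj => ?_
    have := mul_le_mul_of_nonneg_right (hstep j hj) (hk j hj).le
    nlinarith
  set q := ∑ j ∈ Finset.Icc l m, (t j - t (j - 1)) ^ 2
  have hy : 0 ≤ x * τ := mul_nonneg hx hτ
  have hP1 : x * τ ≤ P := by
    have := mul_nonneg (sq_nonneg x) (sub_nonneg.mpr h1)
    linarith
  have hP2 : (x * τ) ^ 2 ≤ 2 * (1 + κ) * P := by
    have h5 : τ ^ 2 ≤ (1 + κ) * (τ ^ 2 - q) := by linarith
    have h6 := mul_le_mul_of_nonneg_left h5 (sq_nonneg x)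
    have h7 : x ^ 2 * ((τ ^ 2 - q) / 2) ≤ P := by linarith
    have h8 := mul_le_mul_of_nonneg_left h7 (by positivity : 0 ≤ 2 * (1 + κ))
    nlinarith
  -- The power `3/2` is the geometric mean of the linear and the quadratic lower bound for `P`.
  calc (x * τ) ^ 3 = (x * τ) * (x * τ) ^ 2 := by ring
    _ ≤ P * (2 * (1 + κ) * P) := mul_le_mul hP1 hP2 (by positivity) (hy.trans hP1)
    _ = _ := by ring

/-- The pointwise bound for the implicit Euler scheme with variable operators, obtained by freezing
the operator at the final step. -/
theorem norm_apply_le {E : Type*} [NormedAddCommGroup E] [InnerProductSpace ℝ E]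
    [FiniteDimensional ℝ E] (t : ℕ → ℝ) {m : ℕ} (hm : 1 ≤ m)
    (hk : ∀ j ∈ Finset.Icc 1 m, 0 < t j - t (j - 1)) {κ : ℝ} (hκ : 0 < κ)
    (hr : ∀ j ∈ Finset.Ico 1 m, t j - t (j - 1) ≤ κ * (t (j + 1) - t j) ∧
      t (j + 1) - t j ≤ κ * (t j - t (j - 1)))
    (A : ℕ → E →ₗ[ℝ] E) (hsym : (A m).IsSymmetric) (N : E → ℝ) (hN0 : ∀ v, 0 ≤ N v)
    {α : ℝ} (hα : 0 < α) (hN : ∀ v, α * N v ^ 2 ≤ inner ℝ (A m v) v)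
    (W : ℕ → ℝ) (hW : ∀ l ∈ Finset.Ico 1 m, 0 ≤ W l)
    (hdiff : ∀ l ∈ Finset.Ico 1 m, ∀ v w, inner ℝ (A m v - A l v) w ≤ W l * N v * N w)
    (u f : ℕ → E) (hu0 : u 0 = 0)
    (hu : ∀ j ∈ Finset.Icc 1 m,
      u j - u (j - 1) + (t j - t (j - 1)) • A j (u j) = (t j - t (j - 1)) • f j) :
    ‖A m (u m)‖ ≤
      ∑ l ∈ Finset.Icc 1 m, (t l - t (l - 1)) * ((t m - t (l - 1))⁻¹ * ‖f l‖) +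
      ∑ l ∈ Finset.Ico 1 m, (t l - t (l - 1)) *
        (W l * N (u l) * √(2 * (1 + κ) / (t m - t (l - 1)) ^ 3 / α)) := by
  let b := hsym.eigenvectorBasis rfl
  let lam := hsym.eigenvalues rfl
  have hb : ∀ i, A m (b i) = lam i • b i := fun i => hsym.apply_eigenvectorBasis rfl i
  have hlam : ∀ i, 0 ≤ lam i := by
    intro i
    have h := hN (b i)
    rw [hb, real_inner_smul_left, real_inner_self_eq_norm_sq, b.orthonormal.1 i] at h
    nlinarith [mul_nonneg hα.le (sq_nonneg (N (b i)))]
  have hAi : ∀ i v, inner ℝ (b i) (A m v) = lam i * inner ℝ (b i) v := by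
    intro i v
    rw [← hsym, hb, real_inner_smul_left]
  have hmono : ∀ l ∈ Finset.Icc 1 m, 0 < t m - t (l - 1) := by
    intro l hl
    rw [Finset.mem_Icc] at hl
    rw [← sum_Icc_sub_pred t hl.2]
    exact Finset.sum_pos (fun j hj => hk j (Finset.Icc_subset_Icc_left hl.1 hj)) ⟨m, by simp [hl.2]⟩
  let P : ℕ → ℝ → ℝ := fun l x => ∏ j ∈ Finset.Icc l m, (1 + (t j - t (j - 1)) * x)
  have hPpos : ∀ l ∈ Finset.Icc 1 m, ∀ i, 0 < P l (lam i) := by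
    intro l hl i
    rw [Finset.mem_Icc] at hl
    exact Finset.prod_pos fun j hj => by
      have := mul_nonneg (hk j (Finset.Icc_subset_Icc_left hl.1 hj)).le (hlam i)
      linarith
  -- `S l` is `A m` times the product of the resolvents `(1 + k_j A m)⁻¹` for `l ≤ j ≤ m`.
  let S : ℕ → E → E := fun l v => ∑ i, (lam i / P l (lam i) * inner ℝ (b i) v) • b i
  have hS : ∀ l v i, inner ℝ (b i) (S l v) = lam i / P l (lam i) * inner ℝ (b i) v := by
    intro l v i
    simp only [S]
    rw [b.orthonormal.inner_right_fintype]
  let g : ℕ → E := fun l => A m (u l) - A l (u l)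
  -- Freezing at the last step makes the diagonal perturbation vanish. This is essential: for a
  -- single factor, `λ ^ (3/2) / (1 + k λ)` is unbounded in `λ`.
  have hgm : S m (g m) = 0 := by simp [S, g]
  have hrep : A m (u m) = ∑ l ∈ Finset.Icc 1 m, (t l - t (l - 1)) • S l (f l) +
      ∑ l ∈ Finset.Icc 1 m, (t l - t (l - 1)) • S l (g l) := by
    rw [← Finset.sum_add_distrib]
    refine b.repr.injective (PiLp.ext fun i => ?_)
    rw [b.repr_apply_apply, b.repr_apply_apply, hAi, inner_sum,
      implicit_euler_formula (fun j => t j - t (j - 1)) (fun j => inner ℝ (b i) (f j + g j))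
        (fun j => inner ℝ (b i) (u j)) (lam i) m (by simp [hu0])
        (fun j hj => by
          have := mul_nonneg (hk j hj).le (hlam i)
          linarith) ?_, Finset.mul_sum]
    · refine Finset.sum_congr rfl fun l _ => ?_
      rw [inner_add_right, inner_add_right, real_inner_smul_right, real_inner_smul_right, hS, hS]
      simp only [P]
      ring
    · intro j hj
      have h := congrArg (inner ℝ (b i)) (hu j hj)
      simp only [g]
      rw [inner_add_right, inner_sub_right, real_inner_smul_right, real_inner_smul_right] at h
      rw [inner_add_right, inner_sub_right, hAi]
      linarith
  rw [hrep]
  refine (norm_add_le _ _).trans (add_le_add ?_ ?_)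
  · refine (norm_sum_le _ _).trans (Finset.sum_le_sum fun l hl => ?_)
    have hl' := Finset.mem_Icc.mp hl
    rw [norm_smul, Real.norm_of_nonneg (hk l hl).le]
    refine mul_le_mul_of_nonneg_left ?_ (hk l hl).le
    refine norm_le_of_abs_inner_le b (inv_nonneg.mpr (hmono l hl).le) fun i => ?_
    rw [hS, abs_mul, abs_of_nonneg (div_nonneg (hlam i) (hPpos l hl i).le)]
    refine mul_le_mul_of_nonneg_right ?_ (abs_nonneg _)
    rw [div_le_iff₀ (hPpos l hl i), inv_mul_eq_div, le_div_iff₀ (hmono l hl)]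
    exact mul_sub_le_prod t hl'.2 (fun j hj => hk j (Finset.Icc_subset_Icc_left hl'.1 hj)) (hlam i)
  · obtain ⟨n, rfl⟩ : ∃ n, m = n + 1 := ⟨m - 1, by omega⟩
    rw [Finset.sum_Icc_succ_top (by omega), hgm, smul_zero, add_zero,
      ← Finset.Ico_succ_right_eq_Icc, Order.succ_eq_add_one]
    refine (norm_sum_le _ _).trans (Finset.sum_le_sum fun l hl => ?_)
    have hl' := Finset.mem_Ico.mp hl
    have hl2 : l ∈ Finset.Icc 1 (n + 1) := Finset.mem_Icc.mpr ⟨hl'.1, hl'.2.le⟩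
    rw [norm_smul, Real.norm_of_nonneg (hk l hl2).le]
    refine mul_le_mul_of_nonneg_left ?_ (hk l hl2).le
    have hτ := hmono l hl2
    refine norm_le_of_energy_bound b (A (n + 1)) lam (fun i => lam i / P l (lam i)) hb N hα
      (by positivity) (mul_nonneg (hW l hl) (hN0 _)) hN (fun i => ?_) (fun w => hdiff l hl (u l) w)
      (hS l _)
    have h3 := cube_le_prod_sq t hl'.2 (fun j hj => hk j (Finset.Icc_subset_Icc_left hl'.1 hj)) hκ
      (fun j hj => hr j (Finset.Ico_subset_Ico_left hl'.1 hj)) (hlam i)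
    rw [le_div_iff₀ (by positivity), div_pow, mul_div_assoc', div_mul_eq_mul_div,
      div_le_iff₀ (pow_pos (hPpos l hl2 i) 2)]
    calc _ = (lam i * (t (n + 1) - t (l - 1))) ^ 3 := by ring
      _ ≤ _ := h3

/-! ### Maximal regularity for the abstract scheme. -/

/-- Unconditional stability of the implicit Euler scheme. -/
theorem norm_le_sum_of_scheme {E : Type*} [NormedAddCommGroup E] [InnerProductSpace ℝ E]
    (k : ℕ → ℝ) (M : ℕ) (hk : ∀ j ∈ Finset.Icc 1 M, 0 ≤ k j) (A : ℕ → E →ₗ[ℝ] E)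
    (hA : ∀ j ∈ Finset.Icc 1 M, ∀ v, 0 ≤ inner ℝ (A j v) v) (u f : ℕ → E) (hu0 : u 0 = 0)
    (hu : ∀ j ∈ Finset.Icc 1 M, u j - u (j - 1) + k j • A j (u j) = k j • f j) {m : ℕ}
    (hm : m ≤ M) : ‖u m‖ ≤ ∑ j ∈ Finset.Icc 1 m, k j * ‖f j‖ := by
  induction m with
  | zero => simp [hu0]
  | succ m ih =>
    have hmem : m + 1 ∈ Finset.Icc 1 M := by rw [Finset.mem_Icc]; omega
    rw [Finset.sum_Icc_succ_top (by omega)]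
    refine le_trans ?_ (add_le_add_left (ih (by omega)) _)
    -- The energy argument: test the step with its own solution and drop the nonnegative operator
    -- term.
    have h := congrArg (fun z => inner ℝ z (u (m + 1))) (hu (m + 1) hmem)
    simp only [Nat.add_sub_cancel] at h
    rw [inner_add_left, inner_sub_left, real_inner_smul_left, real_inner_smul_left,
      real_inner_self_eq_norm_sq] at h
    have h1 := mul_nonneg (hk _ hmem) (hA _ hmem (u (m + 1)))
    have h2 := real_inner_le_norm (u m) (u (m + 1))
    have h3 := mul_le_mul_of_nonneg_left (real_inner_le_norm (f (m + 1)) (u (m + 1))) (hk _ hmem)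
    rcases (norm_nonneg (u (m + 1))).eq_or_lt with h4 | h4
    · rw [← h4]
      have := mul_nonneg (hk _ hmem) (norm_nonneg (f (m + 1)))
      positivity
    · refine le_of_mul_le_mul_right ?_ h4
      nlinarith

/-- Schur's test for the discrete convolution with a decreasing kernel on a grid. -/
theorem wnorm_strict_kernel_le {T : ℝ} (t : ℕ → ℝ) (M : ℕ) (ht0 : t 0 = 0) (htM : t M = T)
    (ht : StrictMonoOn t (Iic M)) {p : ℝ} (hp : 1 ≤ p) (κ Φ : ℝ → ℝ) {B : ℝ} (hB : 0 ≤ B)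
    (hκ : ∀ s ∈ Ioc 0 T, 0 ≤ κ s)
    (hΦ : ∀ x y, 0 < x → x < y → y ≤ T → (y - x) * κ y ≤ Φ y - Φ x)
    (hΦB : ∀ m ∈ Finset.Icc 1 M, ∀ y, t m - t (m - 1) ≤ y → y ≤ T →
      Φ y - Φ (t m - t (m - 1)) ≤ B)
    {x : ℕ → ℝ} (hx : ∀ i ∈ Finset.Icc 1 M, 0 ≤ x i) :
    wnorm (Finset.Icc 1 M) (fun m => t m - t (m - 1)) p
      (fun m => ∑ l ∈ Finset.Ico 1 m, (t l - t (l - 1)) * (κ (t m - t (l - 1)) * x l)) ≤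
      B * wnorm (Finset.Icc 1 M) (fun m => t m - t (m - 1)) p x := by
  have lt : ∀ i j, i < j → j ≤ M → t i < t j := fun i j hij hj =>
    ht (mem_Iic.mpr (by omega)) (mem_Iic.mpr hj) hij
  have le : ∀ i j, i ≤ j → j ≤ M → t i ≤ t j := fun i j hij hj =>
    ht.monotoneOn (mem_Iic.mpr (by omega)) (mem_Iic.mpr hj) hij
  have nonneg : ∀ i ≤ M, 0 ≤ t i := fun i hi => ht0 ▸ le 0 i (by omega) hi
  have leT : ∀ i ≤ M, t i ≤ T := fun i hi => htM ▸ le i M hi le_rfl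
  have hw : ∀ i ∈ Finset.Icc 1 M, 0 ≤ t i - t (i - 1) := fun i hi => by
    rw [Finset.mem_Icc] at hi
    exact sub_nonneg.mpr (le _ _ (by omega) hi.2)
  let K : ℕ → ℕ → ℝ := fun m l => if l < m then κ (t m - t (l - 1)) else 0
  have hrw : ∀ m ∈ Finset.Icc 1 M, ∀ y : ℕ → ℝ,
      ∑ l ∈ Finset.Icc 1 M, (t l - t (l - 1)) * K m l * y l =
        ∑ l ∈ Finset.Ico 1 m, (t l - t (l - 1)) * (κ (t m - t (l - 1)) * y l) := by
    intro m hm y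
    rw [Finset.mem_Icc] at hm
    refine (Finset.sum_subset_zero_on_sdiff (fun l hl => ?_) (fun l hl => ?_) fun l hl => ?_).symm
    · simp only [Finset.mem_Ico, Finset.mem_Icc] at hl ⊢; omega
    · have : ¬ l < m := by
        simp only [Finset.mem_sdiff, Finset.mem_Ico, Finset.mem_Icc] at hl; omega
      simp [K, this]
    · rw [Finset.mem_Ico] at hl
      simp only [K, if_pos hl.2]
      ring
  have hcw : ∀ l ∈ Finset.Icc 1 M, ∑ m ∈ Finset.Icc 1 M, (t m - t (m - 1)) * K m l =
      ∑ m ∈ Finset.Ioc l M, (t m - t (m - 1)) * κ (t m - t (l - 1)) := by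
    intro l hl
    rw [Finset.mem_Icc] at hl
    refine (Finset.sum_subset_zero_on_sdiff (fun m hm => ?_) (fun m hm => ?_) fun m hm => ?_).symm
    · simp only [Finset.mem_Ioc, Finset.mem_Icc] at hm ⊢; omega
    · have : ¬ l < m := by
        simp only [Finset.mem_sdiff, Finset.mem_Ioc, Finset.mem_Icc] at hm; omega
      simp [K, this]
    · rw [Finset.mem_Ioc] at hm
      simp only [K, if_pos hm.1]
  have key := wnorm_kernel_le hw hp K ?_ hB ?_ ?_ hx
  · refine le_trans (le_of_eq ?_) key
    unfold wnorm
    congr 1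
    exact Finset.sum_congr rfl fun m hm => by beta_reduce; rw [hrw m hm]
  · intro m hm l hl
    simp only [K]
    rw [Finset.mem_Icc] at hm hl
    split_ifs with h
    · refine hκ _ ⟨sub_pos.mpr (lt _ _ (by omega) hm.2), ?_⟩
      linarith [leT m hm.2, nonneg (l - 1) (by omega)]
    · exact le_rfl
  · intro m hm
    have := hrw m hm fun _ => 1
    simp only [mul_one] at this
    rw [this]
    have hm' := Finset.mem_Icc.mp hm
    -- The kernel is evaluated at the far end of each cell, so the sum is a lower Riemann sum,
    -- starting at distance `t m - t (m - 1)`. The columns below work the same way.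
    refine (sum_row_le t κ Φ m hm'.1 fun l hl => ?_).trans (hΦB m hm _ ?_ ?_)
    · rw [Finset.mem_Ico] at hl
      have := hΦ (t m - t l) (t m - t (l - 1)) (sub_pos.mpr (lt _ _ hl.2 hm'.2))
        (sub_lt_sub_left (lt _ _ (by omega) (by omega)) _)
        (by linarith [leT m hm'.2, nonneg (l - 1) (by omega)])
      rwa [sub_sub_sub_cancel_left] at this
    · exact sub_le_sub_left (le _ _ (by omega) (by omega)) _
    · rw [ht0, sub_zero]; exact leT m hm'.2
  · intro l hl
    rw [hcw l hl]
    have hl' := Finset.mem_Icc.mp hl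
    refine (sum_col_le t κ Φ l M hl'.2 fun m hm => ?_).trans (hΦB l hl _ ?_ ?_)
    · rw [Finset.mem_Ioc] at hm
      have := hΦ (t (m - 1) - t (l - 1)) (t m - t (l - 1))
        (sub_pos.mpr (lt _ _ (by omega) (by omega)))
        (sub_lt_sub_right (lt _ _ (by omega) (by omega)) _)
        (by linarith [leT m hm.2, nonneg (l - 1) (by omega)])
      rwa [sub_sub_sub_cancel_right] at this
    · exact sub_le_sub_right (le _ _ hl'.2 le_rfl) _
    · rw [htM]; linarith [nonneg (l - 1) (by omega)]

/-- Discrete maximal parabolic regularity for the implicit Euler scheme with variable symmetric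
operators on a finite-dimensional space. -/
theorem discrete_maximal_regularity {E : Type*} [NormedAddCommGroup E] [InnerProductSpace ℝ E]
    [FiniteDimensional ℝ E] {T : ℝ} (t : ℕ → ℝ) (M : ℕ) (ht0 : t 0 = 0) (htM : t M = T)
    (ht : StrictMonoOn t (Iic M)) {κ : ℝ} (hκ : 0 < κ)
    (hr : ∀ j ∈ Finset.Ico 1 M, t j - t (j - 1) ≤ κ * (t (j + 1) - t j) ∧
      t (j + 1) - t j ≤ κ * (t j - t (j - 1)))
    (A : ℕ → E →ₗ[ℝ] E) (hsym : ∀ m ∈ Finset.Icc 1 M, (A m).IsSymmetric)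
    (N : E → ℝ) (hN0 : ∀ v, 0 ≤ N v) {α : ℝ} (hα : 0 < α)
    (hN : ∀ m ∈ Finset.Icc 1 M, ∀ v, α * N v ^ 2 ≤ inner ℝ (A m v) v)
    {D : ℝ} (hD : 0 ≤ D) (ω : ℝ → ℝ) (hω : ∀ s ∈ Ioc 0 T, 0 ≤ ω s)
    (hanti : AntitoneOn (fun s => ω s / s ^ (3 / 2 : ℝ)) (Ioc 0 T))
    (hint : IntegrableOn (fun s => ω s / s ^ (3 / 2 : ℝ)) (Ioc 0 T))
    (hdiff : ∀ m ∈ Finset.Icc 1 M, ∀ l ∈ Finset.Ico 1 m, ∀ v w,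
      inner ℝ (A m v - A l v) w ≤ D * ω (t m - t (l - 1)) * N v * N w)
    (u f : ℕ → E) (hu0 : u 0 = 0)
    (hu : ∀ j ∈ Finset.Icc 1 M,
      u j - u (j - 1) + (t j - t (j - 1)) • A j (u j) = (t j - t (j - 1)) • f j)
    {L : ℝ} (hL0 : 0 ≤ L) (hL : ∀ m ∈ Finset.Icc 1 M, Real.log (T / (t m - t (m - 1))) ≤ L)
    {p : ℝ} (hp : 1 ≤ p) {Z : ℝ}
    (hZ : Z = D * √(2 * (1 + κ) / α) * ∫ s in Ioc 0 T, ω s / s ^ (3 / 2 : ℝ)) :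
    wnorm (Finset.Icc 1 M) (fun m => t m - t (m - 1)) p (fun m => ‖A m (u m)‖) ≤
      (2 * (1 + L) + Z * (Z + 1) * T / α) *
        wnorm (Finset.Icc 1 M) (fun m => t m - t (m - 1)) p (fun m => ‖f m‖) := by
  have lt : ∀ i j, i < j → j ≤ M → t i < t j := fun i j hij hj =>
    ht (mem_Iic.mpr (by omega)) (mem_Iic.mpr hj) hij
  have le : ∀ i j, i ≤ j → j ≤ M → t i ≤ t j := fun i j hij hj =>
    ht.monotoneOn (mem_Iic.mpr (by omega)) (mem_Iic.mpr hj) hij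
  have nonneg : ∀ i ≤ M, 0 ≤ t i := fun i hi => ht0 ▸ le 0 i (by omega) hi
  have leT : ∀ i ≤ M, t i ≤ T := fun i hi => htM ▸ le i M hi le_rfl
  have hT : 0 ≤ T := htM ▸ nonneg M le_rfl
  have hk : ∀ i ∈ Finset.Icc 1 M, 0 < t i - t (i - 1) := fun i hi => by
    rw [Finset.mem_Icc] at hi
    exact sub_pos.mpr (lt _ _ (by omega) hi.2)
  have hw : ∀ i ∈ Finset.Icc 1 M, 0 ≤ t i - t (i - 1) := fun i hi => (hk i hi).le
  let ρ : ℝ → ℝ := fun s => ω s / s ^ (3 / 2 : ℝ)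
  have hρ : ∀ s ∈ Ioc 0 T, 0 ≤ ρ s := fun s hs =>
    div_nonneg (hω s hs) (Real.rpow_nonneg hs.1.le _)
  let S := D * √(2 * (1 + κ) / α)
  have hS : 0 ≤ S := by positivity
  have hJ : 0 ≤ ∫ s in Ioc 0 T, ρ s := setIntegral_nonneg measurableSet_Ioc hρ
  have hZS : Z = S * ∫ s in Ioc 0 T, ρ s := hZ
  have hZ0 : 0 ≤ Z := hZS ▸ mul_nonneg hS hJ
  let nrm := wnorm (Finset.Icc 1 M) (fun m => t m - t (m - 1)) p
  let X : ℕ → ℝ := fun m => ‖A m (u m)‖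
  let F : ℕ → ℝ := fun m => ‖f m‖
  let U : ℕ → ℝ := fun m => ‖u m‖
  let V : ℕ → ℝ := fun m => N (u m)
  have hX0 : ∀ i ∈ Finset.Icc 1 M, 0 ≤ X i := fun i _ => norm_nonneg _
  have hF0 : ∀ i ∈ Finset.Icc 1 M, 0 ≤ F i := fun i _ => norm_nonneg _
  have hU0 : ∀ i ∈ Finset.Icc 1 M, 0 ≤ U i := fun i _ => norm_nonneg _
  have hV0 : ∀ i ∈ Finset.Icc 1 M, 0 ≤ V i := fun i _ => hN0 _
  have hτ : ∀ m ≤ M, ∀ l ∈ Finset.Ico 1 m, t m - t (l - 1) ∈ Ioc 0 T := by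
    intro m hm l hl
    rw [Finset.mem_Ico] at hl
    exact ⟨sub_pos.mpr (lt _ _ (by omega) hm), by linarith [leT m hm, nonneg (l - 1) (by omega)]⟩
  let a : ℕ → ℝ := fun m => ∑ l ∈ Finset.Ico 1 m, (t l - t (l - 1)) * ((t m - t (l - 1))⁻¹ * F l)
  let c : ℕ → ℝ := fun m => ∑ l ∈ Finset.Ico 1 m, (t l - t (l - 1)) * (S * ρ (t m - t (l - 1)) * V l)
  have ha0 : ∀ i ∈ Finset.Icc 1 M, 0 ≤ a i := fun m hm => Finset.sum_nonneg fun l hl => by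
    rw [Finset.mem_Icc] at hm
    have h1 := hτ m hm.2 l hl
    rw [Finset.mem_Ico] at hl
    exact mul_nonneg (hw l (Finset.mem_Icc.mpr ⟨hl.1, by omega⟩))
      (mul_nonneg (inv_nonneg.mpr h1.1.le) (norm_nonneg _))
  have hc0 : ∀ i ∈ Finset.Icc 1 M, 0 ≤ c i := fun m hm => Finset.sum_nonneg fun l hl => by
    rw [Finset.mem_Icc] at hm
    have h1 := hτ m hm.2 l hl
    rw [Finset.mem_Ico] at hl
    exact mul_nonneg (hw l (Finset.mem_Icc.mpr ⟨hl.1, by omega⟩))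
      (mul_nonneg (mul_nonneg hS (hρ _ h1)) (hN0 _))
  have hpt : ∀ m ∈ Finset.Icc 1 M, X m ≤ (F m + a m) + c m := by
    intro m hm
    have hm' := Finset.mem_Icc.mp hm
    have h := norm_apply_le t hm'.1
      (fun j hj => hk j (Finset.Icc_subset_Icc_right hm'.2 hj)) hκ
      (fun j hj => hr j (Finset.Ico_subset_Ico_right hm'.2 hj)) A (hsym m hm) N hN0 hα (hN m hm)
      (fun l => D * ω (t m - t (l - 1)))
      (fun l hl => mul_nonneg hD (hω _ (hτ m hm'.2 l hl))) (hdiff m hm) u f hu0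
      (fun j hj => hu j (Finset.Icc_subset_Icc_right hm'.2 hj))
    refine h.trans (add_le_add (le_of_eq ?_) (le_of_eq (Finset.sum_congr rfl fun l hl => ?_)))
    -- The diagonal term `l = m` is exactly `F m`; it stays outside the convolution.
    · rw [← Finset.Ico_succ_right_eq_Icc, Order.succ_eq_add_one,
        Finset.sum_Ico_succ_top hm'.1, add_comm, mul_inv_cancel_left₀ (hk m hm).ne']
    · have h1 := hτ m hm'.2 l hl
      simp only [ρ, S, V]
      set τ := t m - t (l - 1)
      have e1 : τ ^ (3 / 2 : ℝ) = √(τ ^ 3) := by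
        rw [Real.sqrt_eq_rpow, ← Real.rpow_natCast τ 3, ← Real.rpow_mul h1.1.le]
        norm_num
      rw [e1, div_right_comm, Real.sqrt_div' _ (by have := h1.1; positivity)]
      ring
  have hca : nrm a ≤ L * nrm F := by
    refine wnorm_strict_kernel_le t M ht0 htM ht hp (fun s => s⁻¹) Real.log hL0
      (fun s hs => inv_nonneg.mpr hs.1.le) (fun x y hx hxy hy => ?_) (fun m hm y hy hyT => ?_) hF0
    -- The cell estimate `(y - x) / y ≤ log (y / x)`.
    · have hy0 := hx.trans hxy
      have h := Real.one_sub_inv_le_log_of_pos (div_pos hy0 hx)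
      rw [Real.log_div hy0.ne' hx.ne', inv_div] at h
      refine le_trans (le_of_eq ?_) h
      field_simp
    · have h0 := hk m hm
      rw [← Real.log_div (h0.trans_le hy).ne' h0.ne']
      refine le_trans (Real.log_le_log (div_pos (h0.trans_le hy) h0) ?_) (hL m hm)
      exact div_le_div_of_nonneg_right hyT h0.le
  have hcc : nrm c ≤ Z * nrm V := by
    refine wnorm_strict_kernel_le t M ht0 htM ht hp (fun s => S * ρ s)
      (fun y => S * ∫ s in Ioc 0 y, ρ s) hZ0
      (fun s hs => mul_nonneg hS (hρ s hs)) (fun x y hx hxy hy => ?_) (fun m hm y hy hyT => ?_) hV0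
    · rw [← mul_sub, mul_left_comm]
      refine mul_le_mul_of_nonneg_left ?_ hS
      have hu : Ioc 0 y = Ioc 0 x ∪ Ioc x y := (Ioc_union_Ioc_eq_Ioc hx.le hxy.le).symm
      have i2 : IntegrableOn ρ (Ioc x y) := hint.mono_set (Ioc_subset_Ioc hx.le hy)
      rw [hu, setIntegral_union (Ioc_disjoint_Ioc_of_le le_rfl) measurableSet_Ioc
        (hint.mono_set (Ioc_subset_Ioc_right (hxy.le.trans hy))) i2, add_sub_cancel_left]
      have : (y - x) * ρ y = ∫ s in Ioc x y, ρ y := by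
        rw [setIntegral_const, Real.volume_real_Ioc_of_le hxy.le, smul_eq_mul]
      rw [this]
      refine setIntegral_mono_on (integrableOn_const (by simp)) i2 measurableSet_Ioc
        fun s hs => ?_
      exact hanti ⟨hx.trans hs.1, hs.2.trans hy⟩ ⟨hx.trans hxy, hy⟩ hs.2
    · rw [← mul_sub, hZS]
      refine mul_le_mul_of_nonneg_left ?_ hS
      have h1 : ∫ s in Ioc 0 y, ρ s ≤ ∫ s in Ioc 0 T, ρ s :=
        setIntegral_mono_set hint (ae_restrict_of_forall_mem measurableSet_Ioc hρ)
          (LE.le.eventuallyLE (Ioc_subset_Ioc_right hyT))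
      have h2 : 0 ≤ ∫ s in Ioc 0 (t m - t (m - 1)), ρ s :=
        setIntegral_nonneg measurableSet_Ioc fun s hs => hρ s ⟨hs.1, hs.2.trans (hy.trans hyT)⟩
      linarith
  -- Stability combined with Schur's test for the constant kernel `1`, whose row and column sums are
  -- at most `T`.
  have hUF : nrm U ≤ T * nrm F := by
    have hsum : ∑ j ∈ Finset.Icc 1 M, (t j - t (j - 1)) * 1 ≤ T := by
      simp only [mul_one]
      rcases Nat.eq_zero_or_pos M with h | h
      · subst h; simpa using hT
      · rw [sum_Icc_sub_pred t h]; simp [ht0, htM]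
    refine le_trans (wnorm_mono hw hp hU0 fun m hm => ?_) (wnorm_kernel_le hw hp (fun _ _ => 1)
      (fun _ _ _ _ => zero_le_one) hT (fun _ _ => hsum) (fun _ _ => hsum) hF0)
    have hm' := Finset.mem_Icc.mp hm
    refine (norm_le_sum_of_scheme (fun m => t m - t (m - 1)) M hw A (fun j hj v =>
      (mul_nonneg hα.le (sq_nonneg (N v))).trans (hN j hj v)) u f hu0 hu hm'.2).trans ?_
    simp only [mul_one]
    exact Finset.sum_le_sum_of_subset_of_nonneg (Finset.Icc_subset_Icc_right hm'.2)
      fun j hj _ => mul_nonneg (hw j hj) (norm_nonneg _)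
  -- Chosen so that `Z * ε ≤ 1 / 2`; the summand `1` keeps `ε` finite when `Z = 0`.
  let ε := 1 / (2 * (Z + 1))
  have hε : 0 < ε := by positivity
  have hVX : nrm V ≤ ε * nrm X + (1 / (4 * α * ε)) * nrm U := by
    have h0 : 0 ≤ 1 / (4 * α * ε) := by positivity
    rw [← wnorm_mul hw hp hε.le hX0, ← wnorm_mul hw hp h0 hU0]
    refine le_trans (wnorm_mono hw hp hV0 fun m hm => ?_) (wnorm_add_le hw hp
      (fun i hi => mul_nonneg hε.le (hX0 i hi)) (fun i hi => mul_nonneg h0 (hU0 i hi)))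
    -- Coercivity gives `α V² ≤ ⟨A u, u⟩ ≤ X U`; the rest is Young's inequality.
    refine le_of_sq_le_sq ?_ (add_nonneg (mul_nonneg hε.le (hX0 m hm)) (mul_nonneg h0 (hU0 m hm)))
    have h1 : V m ^ 2 ≤ X m * U m / α := by
      rw [le_div_iff₀ hα, mul_comm]
      exact (hN m hm (u m)).trans (real_inner_le_norm _ _)
    have h2 : X m * U m / α = 4 * (ε * X m) * (1 / (4 * α * ε) * U m) := by field_simp
    rw [h2] at h1
    nlinarith [sq_nonneg (ε * X m - 1 / (4 * α * ε) * U m)]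
  have hmain : nrm X ≤ nrm F + nrm a + nrm c := by
    refine (wnorm_mono hw hp hX0 hpt).trans ?_
    refine (wnorm_add_le hw hp (fun i hi => add_nonneg (hF0 i hi) (ha0 i hi)) hc0).trans ?_
    exact add_le_add_left (wnorm_add_le hw hp hF0 ha0) _
  have hnX : 0 ≤ nrm X := wnorm_nonneg hw hX0
  change nrm X ≤ _ * nrm F
  have e1 : Z * ε ≤ 1 / 2 := by
    simp only [ε]
    rw [mul_one_div, div_le_div_iff₀ (by positivity) (by positivity)]
    linarith
  have e2 : 1 / (4 * α * ε) = (Z + 1) / (2 * α) := by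
    simp only [ε]; field_simp; ring
  rw [e2] at hVX
  have h1 : Z * nrm V ≤ 1 / 2 * nrm X + Z * ((Z + 1) / (2 * α)) * (T * nrm F) := by
    have h2 := mul_le_mul_of_nonneg_left hVX hZ0
    have h3 := mul_le_mul_of_nonneg_right e1 hnX
    have h4 := mul_le_mul_of_nonneg_left hUF (by positivity : 0 ≤ Z * ((Z + 1) / (2 * α)))
    linarith
  -- Half of `nrm X` is absorbed on the left, which doubles the constant.
  have h5 : nrm X ≤ 2 * (nrm F + L * nrm F + Z * ((Z + 1) / (2 * α)) * (T * nrm F)) := by linarith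
  refine h5.trans (le_of_eq ?_)
  field_simp

/-! ### The bilinear form at a fixed time. -/

/-- The time slice of the coefficients is bounded, symmetric and elliptic. -/
structure GoodTime {d : ℕ} (Ω : Set (Pt d)) (a : ℝ → Pt d → Matrix (Fin d) (Fin d) ℝ) (α : ℝ)
    (t : ℝ) : Prop where
  memLp : ∀ i j, MemLp (fun x => a t x i j) ⊤ (volume.restrict Ω)
  symm : ∀ᵐ x ∂(volume.restrict Ω), ∀ i j, a t x i j = a t x j i
  elliptic : ∀ᵐ x ∂(volume.restrict Ω),
    ∀ ξ : Pt d, α * ‖ξ‖ ^ 2 ≤ ∑ i, ∑ j, a t x i j * ξ i * ξ j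

variable {d : ℕ} {T : ℝ} {Ω : Set (Pt d)} {a : ℝ → Pt d → Matrix (Fin d) (Fin d) ℝ} {α : ℝ}
  {ω : ℝ → ℝ}

/-- Fubini for null sets: the assumptions hold a.e. on the product, hence on almost every slice. All
pointwise-in-time facts are restricted to such times. -/
theorem ae_goodTime (ha : CoeffAssumptions T Ω a α ω) :
    ∀ᵐ t ∂(volume.restrict (Ioc 0 T)), GoodTime Ω a α t := by
  rw [← restrict_Ioo_eq_restrict_Ioc]
  have h1 : ∀ i j, ∀ᵐ t ∂(volume.restrict (Ioo 0 T)),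
      MemLp (fun x => a t x i j) ⊤ (volume.restrict Ω) := by
    intro i j
    have hm := ha.memLp_top i j
    filter_upwards [hm.aestronglyMeasurable.prodMk_left,
      Measure.ae_ae_of_ae_prod (ae_le_eLpNormEssSup
        (μ := (volume.restrict (Ioo 0 T)).prod (volume.restrict Ω))
        (f := fun z : ℝ × Pt d => a z.1 z.2 i j))] with t ht1 ht2
    refine ⟨ht1, ?_⟩
    rw [eLpNorm_exponent_top]
    refine (eLpNormEssSup_le_of_ae_enorm_bound ht2).trans_lt ?_
    rw [← eLpNorm_exponent_top]
    exact hm.2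
  filter_upwards [ae_all_iff.mpr fun i => ae_all_iff.mpr (h1 i), Measure.ae_ae_of_ae_prod ha.symm,
    Measure.ae_ae_of_ae_prod ha.elliptic] with t h1 h2 h3
  exact ⟨h1, h2, h3⟩

theorem form_add_left {t : ℝ} (h : GoodTime Ω a α t) (u u' v : L2 Ω × L2Vec Ω) :
    form a t (u + u') v = form a t u v + form a t u' v := by
  rw [form, form, form, ← integral_add (integrable_form a t h.memLp u v)
    (integrable_form a t h.memLp u' v)]
  refine integral_congr_ae ?_
  filter_upwards [Lp.coeFn_add u.2 u'.2] with x hx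
  rw [Prod.snd_add, hx]
  simp only [Pi.add_apply, PiLp.add_apply, mul_add, add_mul, Finset.sum_add_distrib]

theorem form_smul_left (t : ℝ) (c : ℝ) (u v : L2 Ω × L2Vec Ω) :
    form a t (c • u) v = c * form a t u v := by
  rw [form, form, ← integral_const_mul]
  refine integral_congr_ae ?_
  filter_upwards [Lp.coeFn_smul c u.2] with x hx
  rw [Prod.smul_snd, hx]
  simp only [Pi.smul_apply, PiLp.smul_apply, smul_eq_mul, Finset.mul_sum]
  refine Finset.sum_congr rfl fun i _ => Finset.sum_congr rfl fun j _ => ?_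
  ring

theorem form_comm {t : ℝ} (h : GoodTime Ω a α t) (u v : L2 Ω × L2Vec Ω) :
    form a t u v = form a t v u := by
  refine integral_congr_ae ?_
  filter_upwards [h.symm] with x hx
  rw [Finset.sum_comm]
  refine Finset.sum_congr rfl fun i _ => Finset.sum_congr rfl fun j _ => ?_
  rw [hx j i]
  ring

theorem form_zero_right (t : ℝ) (u : L2 Ω × L2Vec Ω) : form a t u 0 = 0 := by
  refine integral_eq_zero_of_ae ?_
  filter_upwards [Lp.coeFn_zero (Pt d) 2 (volume.restrict Ω)] with x hx
  rw [Prod.snd_zero, hx]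
  simp

theorem integral_norm_sq_eq (v : L2Vec Ω) : ∫ x in Ω, ‖v x‖ ^ 2 = ‖v‖ ^ 2 := by
  rw [← real_inner_self_eq_norm_sq, L2.inner_def]
  simp only [real_inner_self_eq_norm_sq]

theorem integrable_norm_sq (v : L2Vec Ω) : Integrable (fun x => ‖v x‖ ^ 2) (volume.restrict Ω) := by
  simpa using (Lp.memLp v).integrable_norm_rpow (by norm_num) (by norm_num)

theorem integral_norm_mul_norm_le (v w : L2Vec Ω) : ∫ x in Ω, ‖v x‖ * ‖w x‖ ≤ ‖v‖ * ‖w‖ := by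
  have h := integral_mul_norm_le_Lp_mul_Lq (p := 2) (q := 2) Real.HolderConjugate.two_two
    (by simpa using Lp.memLp v) (by simpa using Lp.memLp w)
  simp only [Real.rpow_two, integral_norm_sq_eq, ← Real.sqrt_eq_rpow,
    Real.sqrt_sq (norm_nonneg _)] at h
  exact h

theorem le_form_self {t : ℝ} (h : GoodTime Ω a α t) (v : L2 Ω × L2Vec Ω) :
    α * ‖v.2‖ ^ 2 ≤ form a t v v := by
  rw [← integral_norm_sq_eq, ← integral_const_mul]
  refine integral_mono_ae ((integrable_norm_sq v.2).const_mul α)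
    (integrable_form a t h.memLp v v) ?_
  filter_upwards [h.elliptic] with x hx
  exact hx _

/-- The factor `d` comes from using `‖·‖₁ ≤ √d ‖·‖₂` once for each vector. -/
theorem abs_sum_mul_le {b : Matrix (Fin d) (Fin d) ℝ} {B : ℝ} (hB : 0 ≤ B)
    (hb : ∀ i j, |b i j| ≤ B) (ξ η : Pt d) :
    |∑ i, ∑ j, b i j * ξ i * η j| ≤ d * B * (‖ξ‖ * ‖η‖) := by
  have hs : ∀ ξ : Pt d, ∑ i, |ξ i| ≤ √d * ‖ξ‖ := by
    intro ξ
    refine le_of_sq_le_sq ?_ (by positivity)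
    rw [mul_pow, Real.sq_sqrt (by positivity), EuclideanSpace.real_norm_sq_eq]
    have := sq_sum_le_card_mul_sum_sq (s := (Finset.univ : Finset (Fin d))) (f := fun i => |ξ i|)
    simpa using this
  calc |∑ i, ∑ j, b i j * ξ i * η j|
      ≤ ∑ i, ∑ j, B * (|ξ i| * |η j|) := by
        refine (Finset.abs_sum_le_sum_abs _ _).trans (Finset.sum_le_sum fun i _ => ?_)
        refine (Finset.abs_sum_le_sum_abs _ _).trans (Finset.sum_le_sum fun j _ => ?_)
        rw [abs_mul, abs_mul, mul_assoc]
        exact mul_le_mul_of_nonneg_right (hb i j) (by positivity)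
    _ = B * ((∑ i, |ξ i|) * ∑ j, |η j|) := by
        rw [Finset.sum_mul_sum, Finset.mul_sum]
        simp only [Finset.mul_sum]
    _ ≤ B * ((√d * ‖ξ‖) * (√d * ‖η‖)) := by
        have h0 : 0 ≤ ∑ j, |η j| := Finset.sum_nonneg fun _ _ => abs_nonneg _
        exact mul_le_mul_of_nonneg_left
          (mul_le_mul (hs ξ) (hs η) h0 (by positivity)) hB
    _ = _ := by
        rw [show B * ((√d * ‖ξ‖) * (√d * ‖η‖)) = (√d * √d) * B * (‖ξ‖ * ‖η‖) by ring,
          Real.mul_self_sqrt (by positivity)]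

theorem abs_form_sub_le (ha : CoeffAssumptions T Ω a α ω) {s t : ℝ} (hs : s ∈ Icc 0 T)
    (ht : t ∈ Icc 0 T) (gs : GoodTime Ω a α s) (gt : GoodTime Ω a α t) (v w : L2 Ω × L2Vec Ω) :
    |form a s v w - form a t v w| ≤ d * ω |s - t| * (‖v.2‖ * ‖w.2‖) := by
  have hst : |s - t| ∈ Icc 0 T := ⟨abs_nonneg _, abs_le.mpr
    ⟨by linarith [hs.1, ht.2], by linarith [hs.2, ht.1]⟩⟩
  have h0 := ha.omega_nonneg _ hst
  rw [form, form, ← integral_sub (integrable_form a s gs.memLp v w)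
    (integrable_form a t gt.memLp v w)]
  have hvw : Integrable (fun x => ‖v.2 x‖ * ‖w.2 x‖) (volume.restrict Ω) :=
    MemLp.integrable_mul (p := 2) (q := 2) (Lp.memLp v.2).norm (Lp.memLp w.2).norm
  refine (abs_integral_le_integral_abs).trans ((integral_mono_ae
    ((integrable_form a s gs.memLp v w).sub (integrable_form a t gt.memLp v w)).abs
    (hvw.const_mul (d * ω |s - t|)) ?_).trans ?_)
  · filter_upwards [ha.modulus s hs t ht] with x hx
    have := abs_sum_mul_le (b := a s x - a t x) h0 (fun i j => hx i j) (v.2 x) (w.2 x)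
    simpa only [Pi.sub_apply, Matrix.sub_apply, sub_mul, Finset.sum_sub_distrib] using this
  · rw [integral_const_mul]
    exact mul_le_mul_of_nonneg_left (integral_norm_mul_norm_le _ _) (by positivity)

theorem integrableOn_form (ha : CoeffAssumptions T Ω a α ω) (v w : L2 Ω × L2Vec Ω) :
    IntegrableOn (fun t => form a t v w) (Ioc 0 T) := by
  rw [IntegrableOn, ← restrict_Ioo_eq_restrict_Ioc]
  refine Integrable.integral_prod_left (μ := volume.restrict (Ioo 0 T)) (ν := volume.restrict Ω)
    (f := fun z : ℝ × Pt d => ∑ i, ∑ j, a z.1 z.2 i j * v.2 z.2 i * w.2 z.2 j) ?_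
  have hm : ∀ (w : L2Vec Ω) (i : Fin d), MemLp (fun x => w x i) 2 (volume.restrict Ω) :=
    fun w i => (EuclideanSpace.proj i : Pt d →L[ℝ] ℝ).comp_memLp' (Lp.memLp w)
  refine integrable_finsetSum _ fun i _ => integrable_finsetSum _ fun j _ => ?_
  have h1 : Integrable (fun x => v.2 x i * w.2 x j) (volume.restrict Ω) :=
    MemLp.integrable_mul (p := 2) (q := 2) (hm v.2 i) (hm w.2 j)
  have h2 := (h1.comp_snd (volume.restrict (Ioo 0 T))).mul_of_top_right (ha.memLp_top i j)
  simp only [mul_assoc]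
  exact h2

/-! ### Time averages of the form. -/

/-- The time average of the form over `(x, y]`. -/
def avgForm (a : ℝ → Pt d → Matrix (Fin d) (Fin d) ℝ) (x y : ℝ) (v w : L2 Ω × L2Vec Ω) : ℝ :=
  (y - x)⁻¹ * ∫ t in Ioc x y, form a t v w

/-- Used with a half-line for coercivity and with closed balls for the continuity in time. -/
theorem avg_mem_of_ae_mem {x y : ℝ} (hxy : x < y) {g : ℝ → ℝ} (hg : IntegrableOn g (Ioc x y))
    {s : Set ℝ} (hs : Convex ℝ s) (hsc : IsClosed s)
    (h : ∀ᵐ t ∂(volume.restrict (Ioc x y)), g t ∈ s) :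
    (y - x)⁻¹ * ∫ t in Ioc x y, g t ∈ s := by
  have := hs.set_average_mem hsc (by simp [hxy]) (by simp) h hg
  rwa [setAverage_eq, Real.volume_real_Ioc_of_le hxy.le, smul_eq_mul] at this

section avg

variable (ha : CoeffAssumptions T Ω a α ω) {x y : ℝ} (hx : 0 ≤ x) (hxy : x < y) (hy : y ≤ T)
include ha hx hy

theorem ae_goodTime_Ioc : ∀ᵐ t ∂(volume.restrict (Ioc x y)), GoodTime Ω a α t :=
  ae_restrict_of_ae_restrict_of_subset (Ioc_subset_Ioc hx hy) (ae_goodTime ha)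

theorem integrableOn_form_Ioc (v w : L2 Ω × L2Vec Ω) :
    IntegrableOn (fun t => form a t v w) (Ioc x y) :=
  (integrableOn_form ha v w).mono_set (Ioc_subset_Ioc hx hy)

theorem avgForm_add_left (u u' v : L2 Ω × L2Vec Ω) :
    avgForm a x y (u + u') v = avgForm a x y u v + avgForm a x y u' v := by
  rw [avgForm, avgForm, avgForm, ← mul_add, ← integral_add (integrableOn_form_Ioc ha hx hy u v)
    (integrableOn_form_Ioc ha hx hy u' v)]
  congr 1
  refine integral_congr_ae ?_
  filter_upwards [ae_goodTime_Ioc ha hx hy] with t ht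
  exact form_add_left ht u u' v

theorem avgForm_comm (u v : L2 Ω × L2Vec Ω) : avgForm a x y u v = avgForm a x y v u := by
  rw [avgForm, avgForm]
  congr 1
  refine integral_congr_ae ?_
  filter_upwards [ae_goodTime_Ioc ha hx hy] with t ht
  exact form_comm ht u v

include hxy in
theorem le_avgForm_self (v : L2 Ω × L2Vec Ω) : α * ‖v.2‖ ^ 2 ≤ avgForm a x y v v := by
  refine avg_mem_of_ae_mem hxy (integrableOn_form_Ioc ha hx hy v v) (convex_Ici _) isClosed_Ici ?_
  filter_upwards [ae_goodTime_Ioc ha hx hy] with t ht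
  exact le_form_self ht v

end avg

theorem avgForm_smul_left (x y c : ℝ) (u v : L2 Ω × L2Vec Ω) :
    avgForm a x y (c • u) v = c * avgForm a x y u v := by
  simp only [avgForm, form_smul_left, integral_const_mul]
  ring

/-- The two averages are removed one after the other. Times in the two intervals are at most `y' -
x` apart, and for mesh intervals this is the argument `t m - t (l - 1)` of the convolution kernel.
-/
theorem abs_avgForm_sub_le (ha : CoeffAssumptions T Ω a α ω) {x y x' y' : ℝ} (hx : 0 ≤ x)
    (hxy : x < y) (hy : y ≤ x') (hxy' : x' < y') (hy' : y' ≤ T) (v w : L2 Ω × L2Vec Ω) :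
    |avgForm a x' y' v w - avgForm a x y v w| ≤ d * ω (y' - x) * (‖v.2‖ * ‖w.2‖) := by
  have hx' : 0 ≤ x' := by linarith
  have hyT : y ≤ T := by linarith
  have hvw : 0 ≤ ‖v.2‖ * ‖w.2‖ := by positivity
  rw [← Real.dist_eq, ← Metric.mem_closedBall]
  refine avg_mem_of_ae_mem hxy' (integrableOn_form_Ioc ha hx' hy' v w) (convex_closedBall _ _)
    Metric.isClosed_closedBall ?_
  filter_upwards [ae_goodTime_Ioc ha hx' hy', ae_restrict_mem measurableSet_Ioc] with s gs hs
  rw [Metric.mem_closedBall, dist_comm, ← Metric.mem_closedBall]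
  refine avg_mem_of_ae_mem hxy (integrableOn_form_Ioc ha hx hyT v w) (convex_closedBall _ _)
    Metric.isClosed_closedBall ?_
  filter_upwards [ae_goodTime_Ioc ha hx hyT, ae_restrict_mem measurableSet_Ioc] with t gt ht
  rw [Metric.mem_closedBall, Real.dist_eq]
  have hs' : s ∈ Icc 0 T := ⟨by linarith [hs.1], by linarith [hs.2]⟩
  have ht' : t ∈ Icc 0 T := ⟨by linarith [ht.1], by linarith [ht.2]⟩
  refine (abs_form_sub_le ha ht' hs' gt gs v w).trans ?_
  refine mul_le_mul_of_nonneg_right (mul_le_mul_of_nonneg_left ?_ (by positivity)) hvw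
  have hab : |t - s| ≤ y' - x :=
    abs_le.mpr ⟨by linarith [hs.2, ht.1], by linarith [ht.2, hs.1]⟩
  exact ha.omega_mono ⟨abs_nonneg _, by linarith⟩ ⟨by linarith, by linarith⟩ hab

/-! ### Operators on the space of `L²` functions. -/

/-- A symmetric bilinear form on a finite-dimensional space is represented by an operator. -/
theorem exists_operator {E : Type*} [NormedAddCommGroup E] [InnerProductSpace ℝ E]
    [FiniteDimensional ℝ E] (B : E → E → ℝ) (hadd : ∀ u u' v, B (u + u') v = B u v + B u' v)
    (hsmul : ∀ (c : ℝ) u v, B (c • u) v = c * B u v) (hcomm : ∀ u v, B u v = B v u) :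
    ∃ A : E →ₗ[ℝ] E, ∀ v w, inner ℝ (A v) w = B v w := by
  let b := stdOrthonormalBasis ℝ E
  refine ⟨{ toFun := fun v => ∑ i, B v (b i) • b i
            map_add' := fun v v' => by simp only [hadd, add_smul, Finset.sum_add_distrib]
            map_smul' := fun c v => by
              simp only [hsmul, mul_smul, ← Finset.smul_sum, RingHom.id_apply] }, fun v w => ?_⟩
  let ℓ : E →ₗ[ℝ] ℝ :=
    { toFun := fun w => B v w
      map_add' := fun w w' => by rw [hcomm, hadd, hcomm w, hcomm w']
      map_smul' := fun c w => by rw [hcomm, hsmul, hcomm w]; rfl }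
  have h : B v w = ℓ (∑ i, inner ℝ (b i) w • b i) := by rw [b.sum_repr']; rfl
  rw [h, map_sum]
  change inner ℝ (∑ i, B v (b i) • b i) w = _
  rw [sum_inner]
  refine Finset.sum_congr rfl fun i _ => ?_
  rw [real_inner_smul_left, map_smul, smul_eq_mul, mul_comm]
  rfl

/-- The functions (without their gradients) of a space of pairs. -/
def functionSpace (V : Submodule ℝ (L2 Ω × L2Vec Ω)) : Submodule ℝ (L2 Ω) :=
  LinearMap.range ((LinearMap.fst ℝ (L2 Ω) (L2Vec Ω)).comp V.subtype)

instance (V : Submodule ℝ (L2 Ω × L2Vec Ω)) [Module.Finite ℝ V] :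
    FiniteDimensional ℝ (functionSpace V) :=
  inferInstanceAs (Module.Finite ℝ (LinearMap.range _))

/-- Spectral theory needs the `L²` inner product, so it takes place on functions alone. As a
function determines its gradient, the pair is recovered linearly. -/
theorem exists_lift (V : Submodule ℝ (L2 Ω × L2Vec Ω)) (hV : ∀ z ∈ V, z.1 = 0 → z = 0) :
    ∃ J : functionSpace V →ₗ[ℝ] L2 Ω × L2Vec Ω, (∀ v, J v ∈ V) ∧ (∀ v, (J v).1 = v) ∧
      ∀ z ∈ V, ∃ v, J v = z := by
  let q : V →ₗ[ℝ] L2 Ω := (LinearMap.fst ℝ (L2 Ω) (L2Vec Ω)).comp V.subtype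
  have hq : Function.Injective q := by
    rw [← LinearMap.ker_eq_bot, LinearMap.ker_eq_bot']
    exact fun z hz => Subtype.ext (hV z.1 z.2 hz)
  let e : V ≃ₗ[ℝ] functionSpace V := LinearEquiv.ofInjective q hq
  have he : ∀ z : V, ((e z : functionSpace V) : L2 Ω) = z.1.1 := fun z => rfl
  refine ⟨V.subtype.comp e.symm.toLinearMap, fun v => (e.symm v).2, fun v => ?_, fun z hz =>
    ⟨e ⟨z, hz⟩, ?_⟩⟩
  · change (e.symm v).1.1 = v
    rw [← he, LinearEquiv.apply_symm_apply]
  · change ((e.symm (e ⟨z, hz⟩)) : L2 Ω × L2Vec Ω) = z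
    rw [LinearEquiv.symm_apply_apply]

section lift

variable {V : Submodule ℝ (L2 Ω × L2Vec Ω)} [Module.Finite ℝ V]
  {J : functionSpace V →ₗ[ℝ] L2 Ω × L2Vec Ω}

/-- In a fixed basis the dependence on time sits in scalar coefficients, whose integrability is
known; this makes the time integral of the operator computable. -/
theorem discreteOp_eq_sum (hJV : ∀ v, J v ∈ V) (hJ1 : ∀ v, (J v).1 = v)
    (hJs : ∀ z ∈ V, ∃ v, J v = z) {t : ℝ} (ht : GoodTime Ω a α t) {ι : Type*} [Fintype ι]
    (b : OrthonormalBasis ι ℝ (functionSpace V)) (v : functionSpace V) :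
    discreteOp a V t (J v) = ∑ i, form a t (J v) (J (b i)) • J (b i) := by
  obtain ⟨A, hA⟩ := exists_operator (fun v w : functionSpace V => form a t (J v) (J w))
    (fun u u' w => by rw [map_add, form_add_left ht])
    (fun c u w => by rw [map_smul, form_smul_left]) fun u w => form_comm ht _ _
  have hex : ∃ w ∈ V, ∀ χ ∈ V, inner ℝ w.1 χ.1 = form a t (J v) χ := by
    refine ⟨J (A v), hJV _, fun χ hχ => ?_⟩
    obtain ⟨c, rfl⟩ := hJs χ hχ
    rw [hJ1, hJ1, ← hA v c]
    rfl
  rw [discreteOp, dif_pos hex]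
  obtain ⟨h1, h2⟩ := hex.choose_spec
  obtain ⟨c, hc⟩ := hJs _ h1
  rw [← hc]
  have : c = A v := by
    refine ext_inner_right ℝ fun w => ?_
    rw [hA v w, ← h2 (J w) (hJV w), ← hc, hJ1, hJ1]
    rfl
  rw [this, ← b.sum_repr' (A v), map_sum]
  refine Finset.sum_congr rfl fun i _ => ?_
  rw [map_smul, real_inner_comm, hA]

/-- Averaging the operators agrees with representing the averaged form. -/
theorem averagedOp_fst (ha : CoeffAssumptions T Ω a α ω) (hJV : ∀ v, J v ∈ V)
    (hJ1 : ∀ v, (J v).1 = v) (hJs : ∀ z ∈ V, ∃ v, J v = z) (𝒯 : TimeMesh T) (m : ℕ)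
    (h0 : 0 ≤ 𝒯.t (m - 1)) (hT : 𝒯.t m ≤ T) {v z : functionSpace V}
    (hz : ∀ w, inner ℝ z w = avgForm a (𝒯.t (m - 1)) (𝒯.t m) (J v) (J w)) :
    (averagedOp a 𝒯 V m (J v)).1 = z := by
  let b := stdOrthonormalBasis ℝ (functionSpace V)
  have hI : ∫ t in 𝒯.I m, discreteOp a V t (J v) =
      ∑ i, (∫ t in 𝒯.I m, form a t (J v) (J (b i))) • J (b i) := by
    have : ∫ t in 𝒯.I m, discreteOp a V t (J v) =
        ∫ t in 𝒯.I m, ∑ i, form a t (J v) (J (b i)) • J (b i) := by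
      refine integral_congr_ae ?_
      filter_upwards [ae_goodTime_Ioc ha h0 hT] with t ht
      exact discreteOp_eq_sum hJV hJ1 hJs ht b v
    rw [this, integral_finsetSum]
    · exact Finset.sum_congr rfl fun i _ => integral_smul_const _ _
    · exact fun i _ => (integrableOn_form_Ioc ha h0 hT (J v) (J (b i))).smul_const _
  rw [averagedOp, hI, ← b.sum_repr' z, Prod.smul_fst, Prod.fst_sum, Finset.smul_sum,
    Submodule.coe_sum]
  refine Finset.sum_congr rfl fun i _ => ?_
  rw [Prod.smul_fst, hJ1, smul_smul, Submodule.coe_smul, real_inner_comm, hz]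
  rfl

end lift

/-! ### The mesh and the reduction to implicit Euler. -/

theorem TimeMesh.strictMonoOn (𝒯 : TimeMesh T) : StrictMonoOn 𝒯.t (Iic 𝒯.M) := by
  intro i _ j hj hij
  rw [mem_Iic] at hj
  induction j, hij using Nat.le_induction with
  | base => exact 𝒯.t_lt i (by omega)
  | succ n hn ih => exact (ih (by omega)).trans (𝒯.t_lt n (by omega))

theorem TimeMesh.t_mem_I_iff (𝒯 : TimeMesh T) {i m : ℕ} (hi : i ≤ 𝒯.M) (hm : 1 ≤ m)
    (hmM : m ≤ 𝒯.M) : 𝒯.t i ∈ 𝒯.I m ↔ i = m := by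
  have h := 𝒯.strictMonoOn
  rw [TimeMesh.I, mem_Ioc, h.lt_iff_lt (mem_Iic.mpr (by omega)) (mem_Iic.mpr hi),
    h.le_iff_le (mem_Iic.mpr hi) (mem_Iic.mpr hmM)]
  omega

theorem TimeMesh.I_subset (𝒯 : TimeMesh T) {m : ℕ} (hmM : m ≤ 𝒯.M) :
    𝒯.I m ⊆ Ioc 0 T := by
  have h := 𝒯.strictMonoOn.monotoneOn
  refine Ioc_subset_Ioc ?_ ?_
  · rw [← 𝒯.t_zero]
    exact h (mem_Iic.mpr (by omega)) (mem_Iic.mpr (by omega)) (by omega)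
  · conv_rhs => rw [← 𝒯.t_last]
    exact h (mem_Iic.mpr hmM) (mem_Iic.mpr le_rfl) hmM

theorem TimeMesh.disjoint_I (𝒯 : TimeMesh T) {i j : ℕ} (hi : i ≤ 𝒯.M) (hj : j ≤ 𝒯.M)
    (hij : i ≠ j) : Disjoint (𝒯.I i) (𝒯.I j) := by
  have h := 𝒯.strictMonoOn.monotoneOn
  rcases hij.lt_or_gt with hlt | hlt
  · exact Ioc_disjoint_Ioc_of_le (h (mem_Iic.mpr hi) (mem_Iic.mpr (by omega)) (by omega))
  · exact (Ioc_disjoint_Ioc_of_le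
      (h (mem_Iic.mpr hj) (mem_Iic.mpr (by omega)) (by omega))).symm

/-- The dG(0) equations on a single time interval. -/
theorem IsDGSolution.step {𝒯 : TimeMesh T} {V : Submodule ℝ (L2 Ω × L2Vec Ω)} {f : ℝ → L2 Ω}
    {u : ℝ → L2 Ω × L2Vec Ω} (h : IsDGSolution a 𝒯 V f 0 u) {m : ℕ} (hm : 1 ≤ m)
    (hmM : m ≤ 𝒯.M) {w : L2 Ω × L2Vec Ω} (hw : w ∈ V) :
    (∫ t in 𝒯.I m, form a t (u (𝒯.t m)) w) + inner ℝ (jump 𝒯 0 u m) w.1 =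
      ∫ t in 𝒯.I m, inner ℝ (f t) w.1 := by
  have hmem : 𝒯.t m ∈ 𝒯.I m := (𝒯.t_mem_I_iff hmM hm hmM).mpr rfl
  have hconst : ∀ t ∈ 𝒯.I m, u t = u (𝒯.t m) := by
    obtain ⟨z, -, hz⟩ := h.mem m (Finset.mem_Icc.mpr ⟨hm, hmM⟩)
    intro t ht
    rw [hz t ht, hz _ hmem]
  -- A test function living on one interval. Among the nodes, `I m` contains only `t m`, so a single
  -- jump term survives.
  let φ : ℝ → L2 Ω × L2Vec Ω := (𝒯.I m).indicator fun _ => w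
  have hφ : φ ∈ dgSpace 𝒯 V := by
    intro j hj
    rw [Finset.mem_Icc] at hj
    by_cases hjm : j = m
    · subst hjm
      exact ⟨w, hw, fun t ht => indicator_of_mem ht _⟩
    · exact ⟨0, V.zero_mem, fun t ht => indicator_of_notMem
        (Set.disjoint_left.mp (𝒯.disjoint_I hj.2 hmM hjm) ht) _⟩
  have hφt : ∀ j ≤ 𝒯.M, φ (𝒯.t j) = if j = m then w else 0 := by
    intro j hj
    split_ifs with hjm
    · exact indicator_of_mem ((𝒯.t_mem_I_iff hj hm hmM).mpr hjm) _
    · exact indicator_of_notMem (fun hmem => hjm ((𝒯.t_mem_I_iff hj hm hmM).mp hmem)) _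
  have hmeas : MeasurableSet (𝒯.I m) := measurableSet_Ioc
  have hinter : Ioc 0 T ∩ 𝒯.I m = 𝒯.I m := inter_eq_right.mpr (𝒯.I_subset hmM)
  have key := h.eq φ hφ
  have e1 : ∫ t in Ioc 0 T, form a t (u t) (φ t) = ∫ t in 𝒯.I m, form a t (u (𝒯.t m)) w := by
    have : (fun t => form a t (u t) (φ t)) =
        (𝒯.I m).indicator fun t => form a t (u (𝒯.t m)) w := by
      ext t
      by_cases ht : t ∈ 𝒯.I m
      · simp only [φ, indicator_of_mem ht, hconst t ht]
      · simp only [φ, indicator_of_notMem ht, form_zero_right]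
    rw [this, setIntegral_indicator hmeas, hinter]
  have e2 : ∫ t in Ioc 0 T, inner ℝ (f t) (φ t).1 = ∫ t in 𝒯.I m, inner ℝ (f t) w.1 := by
    have : (fun t => inner ℝ (f t) (φ t).1) = (𝒯.I m).indicator fun t => inner ℝ (f t) w.1 := by
      ext t
      by_cases ht : t ∈ 𝒯.I m
      · simp only [φ, indicator_of_mem ht]
      · simp only [φ, indicator_of_notMem ht, Prod.fst_zero, inner_zero_right]
    rw [this, setIntegral_indicator hmeas, hinter]
  have e3 : (∑ j ∈ Finset.Icc 2 𝒯.M,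
      inner ℝ ((u (𝒯.t j)).1 - (u (𝒯.t (j - 1))).1) (φ (𝒯.t j)).1) +
      inner ℝ (u (𝒯.t 1)).1 (φ (𝒯.t 1)).1 = inner ℝ (jump 𝒯 0 u m) w.1 := by
    have e4 : ∑ j ∈ Finset.Icc 2 𝒯.M,
        inner ℝ ((u (𝒯.t j)).1 - (u (𝒯.t (j - 1))).1) (φ (𝒯.t j)).1 =
        ∑ j ∈ Finset.Icc 2 𝒯.M, if j = m then
          inner ℝ ((u (𝒯.t m)).1 - (u (𝒯.t (m - 1))).1) w.1 else 0 := by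
      refine Finset.sum_congr rfl fun j hj => ?_
      rw [hφt j (Finset.mem_Icc.mp hj).2]
      split_ifs with hjm
      · rw [hjm]
      · rw [Prod.fst_zero, inner_zero_right]
    rw [e4, Finset.sum_ite_eq', hφt 1 𝒯.one_le_M, jump]
    by_cases h1 : m = 1
    · subst h1
      simp
    · rw [if_pos (Finset.mem_Icc.mpr ⟨by omega, hmM⟩), if_neg (Ne.symm h1), if_neg h1,
        Prod.fst_zero, inner_zero_right, add_zero]
  rw [formB, add_assoc, e1, e2, e3, inner_zero_left, add_zero] at key
  exact key

theorem mul_norm_average_rpow_le {F : Type*} [NormedAddCommGroup F] [NormedSpace ℝ F] {x y : ℝ}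
    (hxy : x < y) {p : ℝ} (hp : 1 ≤ p) {f : ℝ → F} (hf : IntegrableOn f (Ioc x y))
    (hfp : IntegrableOn (fun t => ‖f t‖ ^ p) (Ioc x y)) :
    (y - x) * ‖(y - x)⁻¹ • ∫ t in Ioc x y, f t‖ ^ p ≤ ∫ t in Ioc x y, ‖f t‖ ^ p := by
  have h0 : 0 < y - x := sub_pos.mpr hxy
  -- Jensen's inequality for `s ↦ s ^ p`.
  have h1 := (convexOn_rpow hp).map_set_average_le (μ := volume) (t := Ioc x y)
    (f := fun t => ‖f t‖) (Real.continuous_rpow_const (by linarith)).continuousOn isClosed_Ici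
    (by simp [hxy]) (by simp) (Filter.Eventually.of_forall fun t => norm_nonneg _) hf.norm hfp
  rw [setAverage_eq, setAverage_eq, Real.volume_real_Ioc_of_le hxy.le, smul_eq_mul,
    smul_eq_mul] at h1
  have h2 : ‖(y - x)⁻¹ • ∫ t in Ioc x y, f t‖ ≤ (y - x)⁻¹ * ∫ t in Ioc x y, ‖f t‖ := by
    rw [norm_smul, Real.norm_of_nonneg (inv_nonneg.mpr h0.le)]
    exact mul_le_mul_of_nonneg_left (norm_integral_le_integral_norm _) (inv_nonneg.mpr h0.le)
  have h3 := (Real.rpow_le_rpow (norm_nonneg _) h2 (by linarith : 0 ≤ p)).trans h1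
  have h4 := mul_le_mul_of_nonneg_left h3 h0.le
  rwa [mul_inv_cancel_left₀ h0.ne'] at h4

/-- Maximal parabolic regularity of the dG(0) method, with a logarithmic bound in terms of the
step sizes. -/
theorem IsDGSolution.maximal_regularity (ha : CoeffAssumptions T Ω a α ω) {𝒯 : TimeMesh T} {κ : ℝ}
    (hκ : 0 < κ)
    (hr : ∀ j ∈ Finset.Ico 1 𝒯.M, 𝒯.k j ≤ κ * 𝒯.k (j + 1) ∧ 𝒯.k (j + 1) ≤ κ * 𝒯.k j)
    {V : Submodule ℝ (L2 Ω × L2Vec Ω)} [Module.Finite ℝ V] (hV : ∀ z ∈ V, z.1 = 0 → z = 0)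
    {L : ℝ} (hL0 : 0 ≤ L) (hL : ∀ m ∈ Finset.Icc 1 𝒯.M, Real.log (T / 𝒯.k m) ≤ L)
    {p : ℝ} (hp : 1 ≤ p) {f : ℝ → L2 Ω}
    (hf : MemLp f (ENNReal.ofReal p) (volume.restrict (Ioo 0 T)))
    {u : ℝ → L2 Ω × L2Vec Ω} (hu : IsDGSolution a 𝒯 V f 0 u) {Z : ℝ}
    (hZ : Z = d * √(2 * (1 + κ) / α) * ∫ s in Ioc 0 T, ω s / s ^ (3 / 2 : ℝ)) :
    (∑ m ∈ Finset.Icc 1 𝒯.M,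
      ((∫ t in 𝒯.I m, ‖(averagedOp a 𝒯 V m (u t)).1‖ ^ p) +
        𝒯.k m * ‖(𝒯.k m)⁻¹ • jump 𝒯 0 u m‖ ^ p)) ^ (1 / p) ≤
      (2 * (2 * (1 + L) + Z * (Z + 1) * T / α) + 1) *
        (∫ t in Ioo 0 T, ‖f t‖ ^ p) ^ (1 / p) := by
  have hp0 : 0 < p := by linarith
  rw [restrict_Ioo_eq_restrict_Ioc] at hf ⊢
  obtain ⟨J, hJV, hJ1, hJs⟩ := exists_lift V hV
  have hmono := 𝒯.strictMonoOn
  have hk : ∀ m ∈ Finset.Icc 1 𝒯.M, 0 < 𝒯.k m := fun m hm => by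
    rw [Finset.mem_Icc] at hm
    exact sub_pos.mpr (hmono (mem_Iic.mpr (by omega)) (mem_Iic.mpr hm.2) (by omega))
  have hlt : ∀ m ∈ Finset.Icc 1 𝒯.M, 𝒯.t (m - 1) < 𝒯.t m := fun m hm => sub_pos.mp (hk m hm)
  have h0 : ∀ i ≤ 𝒯.M, 0 ≤ 𝒯.t i := fun i hi => by
    rw [← 𝒯.t_zero]
    exact hmono.monotoneOn (mem_Iic.mpr (by omega)) (mem_Iic.mpr hi) (by omega)
  have hleT : ∀ i ≤ 𝒯.M, 𝒯.t i ≤ T := fun i hi => by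
    conv_rhs => rw [← 𝒯.t_last]
    exact hmono.monotoneOn (mem_Iic.mpr hi) (mem_Iic.mpr le_rfl) hi
  have h0' : ∀ m ∈ Finset.Icc 1 𝒯.M, 0 ≤ 𝒯.t (m - 1) := fun m hm =>
    h0 _ (by rw [Finset.mem_Icc] at hm; omega)
  have hT' : ∀ m ∈ Finset.Icc 1 𝒯.M, 𝒯.t m ≤ T := fun m hm =>
    hleT _ (Finset.mem_Icc.mp hm).2
  have hsub : ∀ m ∈ Finset.Icc 1 𝒯.M, 𝒯.I m ⊆ Ioc 0 T := fun m hm =>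
    𝒯.I_subset (Finset.mem_Icc.mp hm).2
  have hfint : IntegrableOn f (Ioc 0 T) :=
    hf.integrable (by rw [← ENNReal.ofReal_one]; exact ENNReal.ofReal_le_ofReal hp)
  have hfp : IntegrableOn (fun t => ‖f t‖ ^ p) (Ioc 0 T) := by
    have := hf.integrable_norm_rpow (by simpa using hp0) ENNReal.ofReal_ne_top
    rwa [ENNReal.toReal_ofReal hp0.le] at this
  have hA : ∀ m, ∃ A : functionSpace V →ₗ[ℝ] functionSpace V, m ∈ Finset.Icc 1 𝒯.M →
      ∀ v w, inner ℝ (A v) w = avgForm a (𝒯.t (m - 1)) (𝒯.t m) (J v) (J w) := by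
    intro m
    by_cases hm : m ∈ Finset.Icc 1 𝒯.M
    · obtain ⟨A, hA⟩ := exists_operator
        (fun v w : functionSpace V => avgForm a (𝒯.t (m - 1)) (𝒯.t m) (J v) (J w))
        (fun u u' w => by rw [map_add, avgForm_add_left ha (h0' m hm) (hT' m hm)])
        (fun c u w => by rw [map_smul, avgForm_smul_left])
        fun u w => avgForm_comm ha (h0' m hm) (hT' m hm) _ _
      exact ⟨A, fun _ => hA⟩
    · exact ⟨0, fun h => absurd h hm⟩
  choose A hA using hA
  have hu1 : ∀ m, ∃ v : functionSpace V, m ∈ Finset.Icc 1 𝒯.M → ∀ t ∈ 𝒯.I m, u t = J v := by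
    intro m
    by_cases hm : m ∈ Finset.Icc 1 𝒯.M
    · obtain ⟨z, hzV, hz⟩ := hu.mem m hm
      obtain ⟨v, rfl⟩ := hJs z hzV
      exact ⟨v, fun _ => hz⟩
    · exact ⟨0, fun h => absurd h hm⟩
  choose v hv using hu1
  -- Index `0` carries the initial value. The value of `u` at `t 0` is arbitrary, as this node lies
  -- in no interval `I m` with `1 ≤ m ≤ M`.
  let y : ℕ → functionSpace V := fun m => if m = 0 then 0 else v m
  have hy : ∀ m ∈ Finset.Icc 1 𝒯.M, ∀ t ∈ 𝒯.I m, u t = J (y m) := by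
    intro m hm t ht
    have : m ≠ 0 := by rw [Finset.mem_Icc] at hm; omega
    simp only [y, if_neg this]
    exact hv m hm t ht
  have hyt : ∀ m ∈ Finset.Icc 1 𝒯.M, u (𝒯.t m) = J (y m) := fun m hm =>
    hy m hm _ ((𝒯.t_mem_I_iff (Finset.mem_Icc.mp hm).2 (Finset.mem_Icc.mp hm).1
      (Finset.mem_Icc.mp hm).2).mpr rfl)
  have hjump : ∀ m ∈ Finset.Icc 1 𝒯.M, jump 𝒯 0 u m = ((y m - y (m - 1) : functionSpace V) : L2 Ω) := by
    intro m hm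
    rw [jump, hyt m hm, hJ1, Submodule.coe_sub]
    congr 1
    have hm' := Finset.mem_Icc.mp hm
    split_ifs with h1
    · subst h1
      simp [y]
    · rw [hyt (m - 1) (Finset.mem_Icc.mpr ⟨by omega, by omega⟩), hJ1]
  -- Only the pairing of `f` with discrete functions enters the scheme, so its average may be
  -- projected; projection and averaging do not increase the norm.
  let g : ℕ → functionSpace V := fun m =>
    (functionSpace V).orthogonalProjectionOnto ((𝒯.k m)⁻¹ • ∫ t in 𝒯.I m, f t)
  have hscheme : ∀ m ∈ Finset.Icc 1 𝒯.M,
      y m - y (m - 1) + 𝒯.k m • A m (y m) = 𝒯.k m • g m := by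
    intro m hm
    have hm' := Finset.mem_Icc.mp hm
    refine ext_inner_right ℝ fun w => ?_
    have h := hu.step hm'.1 hm'.2 (hJV w)
    have e1 : inner ℝ (𝒯.k m • A m (y m)) w = 𝒯.k m * inner ℝ (A m (y m)) w :=
      real_inner_smul_left (A m (y m)) w (𝒯.k m)
    have e2 : inner ℝ (𝒯.k m • g m) w = 𝒯.k m * inner ℝ (g m) w :=
      real_inner_smul_left (g m) w (𝒯.k m)
    rw [inner_add_left, e1, e2, hA m hm,
      Submodule.inner_orthogonalProjectionOnto_eq_of_mem_right, real_inner_smul_left,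
      mul_inv_cancel_left₀ (hk m hm).ne', avgForm]
    change _ + 𝒯.k m * ((𝒯.k m)⁻¹ * ∫ t in 𝒯.I m, form a t (J (y m)) (J w)) = _
    rw [mul_inv_cancel_left₀ (hk m hm).ne', real_inner_comm (w : L2 Ω),
      ← integral_inner (hfint.mono_set (hsub m hm)), add_comm]
    rw [hyt m hm, hjump m hm, hJ1] at h
    simp only [real_inner_comm (w : L2 Ω) (f _)] at h
    exact h
  have hw : ∀ m ∈ Finset.Icc 1 𝒯.M, 0 ≤ 𝒯.k m := fun m hm => (hk m hm).le
  have hmain := discrete_maximal_regularity 𝒯.t 𝒯.M 𝒯.t_zero 𝒯.t_last hmono hκ hr A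
    (fun m hm v w => by
      rw [hA m hm, real_inner_comm, hA m hm, avgForm_comm ha (h0' m hm) (hT' m hm)])
    (fun v => ‖(J v).2‖) (fun v => norm_nonneg _) ha.alpha_pos
    (fun m hm v => by
      rw [hA m hm]
      exact le_avgForm_self ha (h0' m hm) (hlt m hm) (hT' m hm) _)
    (Nat.cast_nonneg d) ω (fun s hs => ha.omega_nonneg s ⟨hs.1.le, hs.2⟩) ha.omega_div_anti
    ha.omega_div_integrable
    (fun m hm l hl v w => by
      have hm' := Finset.mem_Icc.mp hm
      have hl' := Finset.mem_Ico.mp hl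
      have hl2 : l ∈ Finset.Icc 1 𝒯.M := Finset.mem_Icc.mpr ⟨hl'.1, by omega⟩
      rw [inner_sub_left, hA m hm, hA l hl2, mul_assoc _ ‖_‖]
      exact (le_abs_self _).trans (abs_avgForm_sub_le ha (h0' l hl2) (hlt l hl2)
        (hmono.monotoneOn (mem_Iic.mpr (by omega)) (mem_Iic.mpr (by omega)) (by omega))
        (hlt m hm) (hT' m hm) _ _))
    y g (by simp [y]) hscheme hL0 hL hp hZ
  set H := 2 * (1 + L) + Z * (Z + 1) * T / α
  change wnorm _ 𝒯.k p _ ≤ H * wnorm _ 𝒯.k p _ at hmain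
  have hgf : wnorm (Finset.Icc 1 𝒯.M) 𝒯.k p (fun m => ‖g m‖) ≤
      (∫ t in Ioc 0 T, ‖f t‖ ^ p) ^ (1 / p) := by
    refine Real.rpow_le_rpow (Finset.sum_nonneg fun m hm => mul_nonneg (hw m hm)
      (Real.rpow_nonneg (norm_nonneg _) _)) ?_ (by positivity)
    calc _ ≤ ∑ m ∈ Finset.Icc 1 𝒯.M, ∫ t in 𝒯.I m, ‖f t‖ ^ p := by
          refine Finset.sum_le_sum fun m hm => ?_
          refine le_trans ?_ (mul_norm_average_rpow_le (hlt m hm) hp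
            (hfint.mono_set (hsub m hm)) (hfp.mono_set (hsub m hm)))
          refine mul_le_mul_of_nonneg_left (Real.rpow_le_rpow (norm_nonneg _) ?_ hp0.le) (hw m hm)
          exact Submodule.norm_orthogonalProjectionOnto_apply_le _ _
      _ = ∫ t in ⋃ m ∈ Finset.Icc 1 𝒯.M, 𝒯.I m, ‖f t‖ ^ p := by
          refine (integral_biUnion_finset _ (fun _ _ => measurableSet_Ioc) ?_
            fun m hm => hfp.mono_set (hsub m hm)).symm
          intro i hi j hj hij
          exact 𝒯.disjoint_I (Finset.mem_Icc.mp hi).2 (Finset.mem_Icc.mp hj).2 hij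
      _ ≤ _ := setIntegral_mono_set hfp
          (Filter.Eventually.of_forall fun t => Real.rpow_nonneg (norm_nonneg _) _)
          (LE.le.eventuallyLE (iUnion₂_subset hsub))
  have hX : ∀ m ∈ Finset.Icc 1 𝒯.M, ∫ t in 𝒯.I m, ‖(averagedOp a 𝒯 V m (u t)).1‖ ^ p =
      𝒯.k m * ‖A m (y m)‖ ^ p := by
    intro m hm
    have : ∀ t ∈ 𝒯.I m, ‖(averagedOp a 𝒯 V m (u t)).1‖ ^ p = ‖A m (y m)‖ ^ p := by
      intro t ht
      rw [hy m hm t ht, averagedOp_fst ha hJV hJ1 hJs 𝒯 m (h0' m hm) (hT' m hm)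
        (fun w => hA m hm (y m) w), Submodule.coe_norm]
    rw [setIntegral_congr_fun (show MeasurableSet (𝒯.I m) from measurableSet_Ioc) this, setIntegral_const, TimeMesh.I,
      Real.volume_real_Ioc_of_le (hlt m hm).le, smul_eq_mul]
    rfl
  let Y : ℕ → ℝ := fun m => ‖(𝒯.k m)⁻¹ • jump 𝒯 0 u m‖
  have hY : ∀ m ∈ Finset.Icc 1 𝒯.M, Y m ≤ ‖g m‖ + ‖A m (y m)‖ := by
    intro m hm
    -- The scheme expresses the jump quotient by terms already bounded. With `hsplit` the total
    -- factor is `H + (1 + H) = 2 * H + 1`.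
    have e : (𝒯.k m)⁻¹ • (y m - y (m - 1)) = g m - A m (y m) := by
      rw [eq_sub_of_add_eq (hscheme m hm), ← smul_sub, inv_smul_smul₀ (hk m hm).ne']
    simp only [Y]
    rw [hjump m hm, ← Submodule.coe_smul, e, Submodule.norm_coe]
    exact norm_sub_le _ _
  have hYn : wnorm (Finset.Icc 1 𝒯.M) 𝒯.k p Y ≤
      wnorm (Finset.Icc 1 𝒯.M) 𝒯.k p (fun m => ‖g m‖) +
        wnorm (Finset.Icc 1 𝒯.M) 𝒯.k p (fun m => ‖A m (y m)‖) :=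
    (wnorm_mono hw hp (fun _ _ => norm_nonneg _) hY).trans
      (wnorm_add_le hw hp (fun _ _ => norm_nonneg _) fun _ _ => norm_nonneg _)
  have hsplit : (∑ m ∈ Finset.Icc 1 𝒯.M,
      ((∫ t in 𝒯.I m, ‖(averagedOp a 𝒯 V m (u t)).1‖ ^ p) +
        𝒯.k m * ‖(𝒯.k m)⁻¹ • jump 𝒯 0 u m‖ ^ p)) ^ (1 / p) ≤
      wnorm (Finset.Icc 1 𝒯.M) 𝒯.k p (fun m => ‖A m (y m)‖) +
        wnorm (Finset.Icc 1 𝒯.M) 𝒯.k p Y := by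
    rw [Finset.sum_add_distrib, Finset.sum_congr rfl hX]
    exact Real.rpow_add_le_add_rpow
      (Finset.sum_nonneg fun m hm => mul_nonneg (hw m hm) (Real.rpow_nonneg (norm_nonneg _) _))
      (Finset.sum_nonneg fun m hm => mul_nonneg (hw m hm) (Real.rpow_nonneg (norm_nonneg _) _))
      (by positivity) (by rw [div_le_one hp0]; exact hp)
  have hT0 : 0 ≤ T := 𝒯.t_last ▸ h0 𝒯.M le_rfl
  have hZ0 : 0 ≤ Z := by
    rw [hZ]
    refine mul_nonneg (by positivity) (setIntegral_nonneg measurableSet_Ioc fun s hs => ?_)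
    exact div_nonneg (ha.omega_nonneg s ⟨hs.1.le, hs.2⟩) (Real.rpow_nonneg hs.1.le _)
  have hH : 0 ≤ H := by have := ha.alpha_pos; positivity
  have := mul_le_mul_of_nonneg_left hgf (by positivity : 0 ≤ 2 * H + 1)
  linarith

/-! ### The logarithmic factor and the conclusion. -/

theorem one_le_log_four : 1 ≤ Real.log 4 := by
  rw [show (4 : ℝ) = 2 ^ 2 by norm_num, Real.log_pow]
  have := Real.log_two_gt_d9
  push_cast
  linarith

theorem TimeMesh.kmax_pos (𝒯 : TimeMesh T) : 0 < 𝒯.kmax :=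
  (sub_pos.mpr (𝒯.strictMonoOn (mem_Iic.mpr (by omega)) (mem_Iic.mpr 𝒯.one_le_M)
    (by omega))).trans_le (Finset.le_sup' 𝒯.k (Finset.mem_Icc.mpr ⟨le_rfl, 𝒯.one_le_M⟩))

/-- This is what `k ≤ T / 4` is for: additive constants can be absorbed into the logarithm. -/
theorem TimeMesh.Admissible.one_le_log {𝒯 : TimeMesh T} {c β κ : ℝ} (h : 𝒯.Admissible c β κ) :
    1 ≤ Real.log (T / 𝒯.kmax) := by
  refine one_le_log_four.trans (Real.log_le_log (by norm_num) ?_)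
  rw [le_div_iff₀ 𝒯.kmax_pos]
  linarith [h.kmax_le]

/-- Taking logarithms in `c k ^ β ≤ k_m` gives `log (T / k_m) ≤ (log T - log c - β log T) + β log (T
/ k)`, and the constant is absorbed. -/
theorem TimeMesh.Admissible.log_step_le {𝒯 : TimeMesh T} {c β κ : ℝ} (h : 𝒯.Admissible c β κ)
    (hT : 0 < T) (hc : 0 < c) {m : ℕ} (hm : m ∈ Finset.Icc 1 𝒯.M) :
    Real.log (T / 𝒯.k m) ≤
      (|Real.log T - Real.log c - β * Real.log T| + β) * Real.log (T / 𝒯.kmax) := by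
  have hkm := 𝒯.kmax_pos
  have h1 : c * 𝒯.kmax ^ β ≤ 𝒯.k m := h.kmin_ge.trans (Finset.inf'_le 𝒯.k hm)
  have h2 : 0 < c * 𝒯.kmax ^ β := by positivity
  have h3 := Real.log_le_log h2 h1
  rw [Real.log_mul hc.ne' (by positivity), Real.log_rpow hkm] at h3
  have h4 := h.one_le_log
  have h5 : Real.log (T / 𝒯.kmax) = Real.log T - Real.log 𝒯.kmax := Real.log_div hT.ne' hkm.ne'
  rw [Real.log_div hT.ne' (h2.trans_le h1).ne']
  have h6 := le_abs_self (Real.log T - Real.log c - β * Real.log T)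
  have h7 := mul_le_mul_of_nonneg_left h4 (abs_nonneg (Real.log T - Real.log c - β * Real.log T))
  rw [add_mul]
  have h8 : β * Real.log (T / 𝒯.kmax) = β * Real.log T - β * Real.log 𝒯.kmax := by rw [h5]; ring
  linarith

end DGMaxReg

end

open DGMaxReg
theorem corollary3p6 {d : ℕ} (hd : 1 ≤ d) (T : ℝ) (hT : 0 < T)
    (Ω : Set (Pt d)) (hΩ : IsOpen Ω)
    (a : ℝ → Pt d → Matrix (Fin d) (Fin d) ℝ) (α : ℝ) (ω : ℝ → ℝ)
    (ha : CoeffAssumptions T Ω a α ω)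
    (c β κ : ℝ) (hc : 0 < c) (hβ : 0 < β) (hκ : 0 < κ) :
    ∃ μ > 0, ∃ δ₀ > 0, ∃ C > 0,
      ∀ 𝒯 : TimeMesh T, 𝒯.Admissible c β κ → 𝒯.kmax - 𝒯.kmin ≤ δ₀ →
      ∀ K : Geometry.SimplicialComplex ℝ (Pt d), IsTriangulation K Ω →
      ∀ r : ℕ, 1 ≤ r →
      ∀ p : ℝ, 1 ≤ p →
      ∀ f : ℝ → L2 Ω, MemLp f (ENNReal.ofReal p) (volume.restrict (Ioo 0 T)) →
      ∀ u : ℝ → L2 Ω × L2Vec Ω, IsDGSolution a 𝒯 (feSpace Ω K r) f 0 u →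
        (∑ m ∈ Finset.Icc 1 𝒯.M,
          ((∫ t in 𝒯.I m, ‖(averagedOp a 𝒯 (feSpace Ω K r) m (u t)).1‖ ^ p) +
            𝒯.k m * ‖(𝒯.k m)⁻¹ • jump 𝒯 0 u m‖ ^ p)) ^ (1 / p) ≤
          C * Real.exp (μ * T) * Real.log (T / 𝒯.kmax) *
            (∫ t in Ioo 0 T, ‖f t‖ ^ p) ^ (1 / p) := by
  obtain ⟨Z, hZ⟩ : ∃ Z, Z = d * √(2 * (1 + κ) / α) * ∫ s in Ioc 0 T, ω s / s ^ (3 / 2 : ℝ) :=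
    ⟨_, rfl⟩
  have hα := ha.alpha_pos
  have hZ0 : 0 ≤ Z := by
    rw [hZ]
    refine mul_nonneg (by positivity) (setIntegral_nonneg measurableSet_Ioc fun s hs => ?_)
    exact div_nonneg (ha.omega_nonneg s ⟨hs.1.le, hs.2⟩) (Real.rpow_nonneg hs.1.le _)
  let G := |Real.log T - Real.log c - β * Real.log T| + β
  have hG : 0 < G := by positivity
  let H := Z * (Z + 1) * T / α
  have hH : 0 ≤ H := by positivity
  -- `C` is read off from `2 * (2 * (1 + G * l) + H) + 1` with `l ≥ 1`. The bound holds without the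
  -- exponential factor, which is at least `1`, so any positive `μ` would do.
  refine ⟨1, one_pos, 1, one_pos, 5 + 4 * G + 2 * H, by positivity, ?_⟩
  intro 𝒯 h𝒯 _ K hK r _ p hp f hf u hu
  have := feSpace_finite hΩ hK r
  have hl := h𝒯.one_le_log
  set l := Real.log (T / 𝒯.kmax)
  have hk : ∀ m ∈ Finset.Icc 1 𝒯.M, 0 < 𝒯.k m := fun m hm => by
    rw [Finset.mem_Icc] at hm
    exact sub_pos.mpr (𝒯.strictMonoOn (mem_Iic.mpr (by omega)) (mem_Iic.mpr hm.2) (by omega))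
  have hr : ∀ j ∈ Finset.Ico 1 𝒯.M, 𝒯.k j ≤ κ * 𝒯.k (j + 1) ∧ 𝒯.k (j + 1) ≤ κ * 𝒯.k j := by
    intro j hj
    rw [Finset.mem_Ico] at hj
    obtain ⟨h1, h2⟩ := h𝒯.ratio j (Finset.mem_Icc.mpr ⟨hj.1, by omega⟩)
    have h3 := hk (j + 1) (Finset.mem_Icc.mpr ⟨by omega, by omega⟩)
    rw [le_div_iff₀ h3, inv_mul_le_iff₀ hκ] at h1
    rw [div_le_iff₀ h3] at h2
    exact ⟨h2, h1⟩
  refine (hu.maximal_regularity ha hκ hr (fun z (hz : z ∈ feSpace Ω K r) => H10_eq_zero hz.1)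
    (by positivity : 0 ≤ G * l) (fun m hm => h𝒯.log_step_le hT hc hm) hp hf hZ).trans ?_
  refine mul_le_mul_of_nonneg_right ?_ (Real.rpow_nonneg
    (integral_nonneg fun t => Real.rpow_nonneg (norm_nonneg _) _) _)
  have hexp : 1 ≤ Real.exp (1 * T) := Real.one_le_exp (by linarith)
  have h1 : 2 * (2 * (1 + G * l) + H) + 1 ≤ (5 + 4 * G + 2 * H) * l := by
    have := mul_le_mul_of_nonneg_left hl (by positivity : 0 ≤ 5 + 2 * H)
    linarith
  refine h1.trans (mul_le_mul_of_nonneg_right ?_ (by linarith))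
  exact le_mul_of_one_le_right (by positivity) hexp
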